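/- **Setting.** Let $\hbar>0$, let $\alpha,\beta,\gamma,\delta,\xi,\mu,E,\lambda$ be real constants, and let $f$ on an open interval $I$ and $g$ on an open interval $J$ be real $C^2$ solutions of $$\ddot f=\alpha f^2+\beta f+\gamma,\qquad g''=-\alpha g^2+\delta g+\xi,$$ with $\ddot f(x)^2+g''(y)^2$ not identically zero on $I\times J$. Put $\Omega=\ddot f+g''$, $k_1=-g'$, $k_2=-\dot f$, $$W=-\tfrac{\alpha}{3}(f-g)^3-\tfrac{\beta+\delta}{2}(f-g)^2+(\xi-\gamma+\mu)(f-g),$$ $$m=-\tfrac{\alpha}{3}(g^3+2f^3-3gf^2)+\beta(fg-f^2)-\tfrac{\delta}{2}(f^2-g^2)-\gamma(2f-g)+\mu f+\xi g .$$ A vector potential is a pair $(A,B)$ of real smooth functions on $I\times J$ with $A_y-B_x=\Omega$. With $V=W+\frac12(A^2+B^2)$ let $$H=-\tfrac{\hbar^2}{2}(\partial_x^2+\partial_y^2)-\tfrac{i\hbar}{2}(A\partial_x+\partial_xA+B\partial_y+\partial_yB)+V,$$ $$X=-\tfrac{\hbar^2}{2}\partial_x^2-i\hbar[(A+k_1)\partial_x+k_2\partial_y]-\tfrac{i\hbar}{2}(A_x+k_{1x}+k_{2y})+\tfrac12A^2+m+k_1A+k_2B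 .$$ For a real function $\phi(x,y)$, the equation $\{(H-E)+\phi(X-\lambda)\}\Psi=0$ *separates* if there are a nowhere vanishing function $\rho(x,y)$ and ordinary differential operators $L_1$ in $x$ and $L_2$ in $y$, of order at most two, such that $\{(H-E)+\phi(X-\lambda)\}(vw)=\rho\,\big((L_1v)w+v(L_2w)\big)$ for all $C^2$ functions $v(x)$, $w(y)$. *Quasiseparation* occurs if this holds for some vector potential $(A,B)$ and some $\phi$. For constants $k,c_1,c_2$, signs $\epsilon_1,\epsilon_2=\pm1$ and functions $\tau(x),\eta(y)$, the triple $(\phi,A,B)$ has *standard form* if $$1+\phi=\frac{\epsilon_1\sqrt{c_1-2kf}}{\epsilon_2\sqrt{c_2+2kg}}\sqrt{\frac{g'^2}{\dot f^2}},\qquad A=\tau+\frac{\phi}{1+\phi}g',\qquad B=\eta+\phi\dot f,$$ where the first formula is required at the points with $\dot f g'\neq0$, and there $(c_1-2kf)(c_2+2kg)>0$ (both roots are real, or both imaginary). **Tables.** For $\alpha>0$ put $\omega_1^2=\frac14\sqrt{\beta^2-4\alpha\gamma}$, $\omega_2^2=\frac14\sqrt{\delta^2+4\alpha\xi}$, and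 in rows 2–4 assume $\beta^2-4\alpha\gamma>0$, $f_3-f_1=6\omega_1^2/\alpha$, respectively $\delta^2+4\alpha\xi>0$, $g_3-g_1=6\omega_2^2/\alpha$. * $F_1$: $f=\frac{6}{\alpha(x-x_0)^2}-\frac{\beta}{2\alpha}$, $c_1=-\frac{k\beta}{\alpha}$. * $F_2$: $f=f_1+\frac{f_3-f_1}{\sin^2\omega_1(x-x_0)}$, $f_1=\frac{-\beta-\sqrt{\beta^2-4\alpha\gamma}}{2\alpha}$, $c_1=2kf_3$. * $F_3$: $f=f_1+(f_3-f_1)\tanh^2\omega_1(x-x_0)$, $f_3=\frac{-\beta+\sqrt{\beta^2-4\alpha\gamma}}{2\alpha}$, $c_1=2kf_1$. * $F_4$: $f=f_1+\frac{f_3-f_1}{\tanh^2\omega_1(x-x_0)}$, $f_3$ as in $F_3$, $c_1=2kf_1$. * $G_1$: $g=\frac{\delta}{2\alpha}-\frac{6}{\alpha(y-y_0)^2}$, $c_2=-\frac{k\delta}{\alpha}$. * $G_2$: $g=g_3-\frac{g_3-g_1}{\tanh^2\omega_2(y-y_0)}$, $g_1=\frac{\delta-\sqrt{\delta^2+4\alpha\xi}}{2\alpha}$,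 $c_2=-2kg_3$. * $G_3$: $g=g_3-(g_3-g_1)\tanh^2\omega_2(y-y_0)$, $g_1$ as in $G_2$, $c_2=-2kg_3$. * $G_4$: $g=g_3-\frac{g_3-g_1}{\sin^2\omega_2(y-y_0)}$, $g_3=\frac{\delta+\sqrt{\delta^2+4\alpha\xi}}{2\alpha}$, $c_2=-2kg_1$. The poles $x_0,y_0,\dots$ must not lie in $I$, $J$. For $\alpha<0$, $f$ is of type $F_r$ if $-f$ is of type $F_r$ for the constants $(-\alpha,\beta,-\gamma)$, and $g$ is of type $G_s$ if $-g$ is of type $G_s$ for $(-\alpha,\delta,-\xi)$; $c_1$, $c_2$ are then the table values for these constants with $k$ replaced by $-k$. The *sign relation* for $(F_r,G_s)$ is $\epsilon_1=\epsilon_2$ if exactly one of $r,s$ is $3$, and $\epsilon_1=-\epsilon_2$ otherwise. **Theorem.** (a) If $f$ and $g$ are not constant, quasiseparation occurs if and only if one of the following holds: 1. $\alpha=\delta=\xi=0$ and $g=g_0y+g_1$; 2. $\alpha=0$, $\delta>0$ and $g=g_1e^{\sqrt\delta y}+g_2e^{-\sqrt\delta y}-\frac{\xi}{\delta}$ with $g_1g_2=0$;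 3. $\alpha=\beta=\delta=0$, $\xi\gamma<0$, and $f=\frac12\gamma(x-x_0)^2+f_0$, $g=\frac12\xi(y-y_0)^2+g_0$; 4. $\alpha\ne0$, $f$ is one of $F_1,\dots,F_4$ and $g$ is one of $G_1,\dots,G_4$. (b) In cases 1 and 2 (also for constant $f$ or $g$) the equation separates for $\phi=-1$, $A=g'+\tau(x)$, $B=-\dot f+\eta(y)$, with arbitrary smooth $\tau,\eta$. (c) In case 3 it separates for the constants $\phi=-1\pm\sqrt{-\xi/\gamma}$ with $A=\frac{\phi}{1+\phi}g'+\tau(x)$, $B=\phi\dot f+\eta(y)$, $\tau,\eta$ arbitrary smooth. This is the standard form for every $k\ne0$, with $c_1=2kf_0$, $c_2=-2kg_0$ (so $c_1=c_2=0$ if $f_0=g_0=0$) and $\epsilon_1/\epsilon_2=\pm1$. (d) In case 4, for every $k\neq0$, all signs satisfying the sign relation and all smooth $\tau,\eta$ (for instance $\tau=\eta=0$), there is a separating triple $(\phi,A,B)$, with $\phi$ smooth on $I\times J$ and $(A,B)$ a vector potential, in the standard form with $c_1,c_2$ from the tables. Conversely every separating triple has this form with some smooth $\tau,\eta$ (for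 all such $k,\epsilon_1,\epsilon_2$), and whenever a separating triple is written in standard form with some $k,c_1,c_2,\epsilon_1,\epsilon_2$, then $k\ne0$, $c_1$ and $c_2$ are the table values, and the sign relation holds. (e) Let $\alpha\ne0$, let $f,g$ be nonconstant, and let $\sigma_1,\sigma_2$ be the constants with $\dot f^2=P_3(f)$, $g'^2=Q_3(g)$, where $P_3(t)=\frac23\alpha t^3+\beta t^2+2\gamma t+\sigma_1$ and $Q_3(t)=-\frac23\alpha t^3+\delta t^2+2\xi t+\sigma_2$. If $P_3$ or $Q_3$ has three distinct complex roots (the case of elliptic functions), quasiseparation does not occur. -/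

import Mathlib

open scoped ContDiff

noncomputable section

/-- Partial derivative in the first variable. -/
def dx {F : Type*} [NormedAddCommGroup F] [NormedSpace ℝ F] (u : ℝ → ℝ → F) (x y : ℝ) : F :=
  deriv (fun s => u s y) x

/-- Partial derivative in the second variable. -/
def dy {F : Type*} [NormedAddCommGroup F] [NormedSpace ℝ F] (u : ℝ → ℝ → F) (x y : ℝ) : F :=
  deriv (fun s => u x s) y

/-- The data of a Cartesian integrable system in a magnetic field: real constants and two real
functions `f`, `g` on open intervals `I`, `J` with `f'' = α f² + β f + γ` and
`g'' = -α g² + δ g + ξ`. -/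
structure CartesianSystem where
  hbar : ℝ
  α : ℝ
  β : ℝ
  γ : ℝ
  δ : ℝ
  ξ : ℝ
  μ : ℝ
  I : Set ℝ
  J : Set ℝ
  f : ℝ → ℝ
  g : ℝ → ℝ
  hbar_pos : 0 < hbar
  I_open : IsOpen I
  I_interval : I.OrdConnected
  I_nonempty : I.Nonempty
  J_open : IsOpen J
  J_interval : J.OrdConnected
  J_nonempty : J.Nonempty
  f_contDiff : ContDiffOn ℝ 2 f I
  g_contDiff : ContDiffOn ℝ 2 g J
  f_ode : ∀ x ∈ I, deriv (deriv f) x = α * f x ^ 2 + β * f x + γ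
  g_ode : ∀ y ∈ J, deriv (deriv g) y = -α * g y ^ 2 + δ * g y + ξ

namespace CartesianSystem

variable (S : CartesianSystem)

/-- The magnetic field. -/
def Ω (x y : ℝ) : ℝ := deriv (deriv S.f) x + deriv (deriv S.g) y

/-- The effective potential. -/
def W (x y : ℝ) : ℝ :=
  -(S.α / 3) * (S.f x - S.g y) ^ 3 - (S.β + S.δ) / 2 * (S.f x - S.g y) ^ 2
    + (S.ξ - S.γ + S.μ) * (S.f x - S.g y)

def k₁ (_x y : ℝ) : ℝ := -deriv S.g y

def k₂ (x _y : ℝ) : ℝ := -deriv S.f x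

def m (x y : ℝ) : ℝ :=
  -(S.α / 3) * (S.g y ^ 3 + 2 * S.f x ^ 3 - 3 * S.g y * S.f x ^ 2)
    + S.β * (S.f x * S.g y - S.f x ^ 2) - S.δ / 2 * (S.f x ^ 2 - S.g y ^ 2)
    - S.γ * (2 * S.f x - S.g y) + S.μ * S.f x + S.ξ * S.g y

/-- The scalar potential belonging to the gauge `(A, B)`. -/
def V (A B : ℝ → ℝ → ℝ) (x y : ℝ) : ℝ := S.W x y + (A x y ^ 2 + B x y ^ 2) / 2

/-- `(A, B)` is a smooth vector potential of the magnetic field on `I × J`. -/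
def IsVectorPotential (A B : ℝ → ℝ → ℝ) : Prop :=
  ContDiffOn ℝ ∞ (Function.uncurry A) (S.I ×ˢ S.J) ∧
  ContDiffOn ℝ ∞ (Function.uncurry B) (S.I ×ˢ S.J) ∧
  ∀ x ∈ S.I, ∀ y ∈ S.J, dy A x y - dx B x y = S.Ω x y

/-- The Hamiltonian
`-(ħ²/2)(∂x² + ∂y²) - (iħ/2)(A ∂x + ∂x A + B ∂y + ∂y B) + V`, acting on wave functions. -/
def H (A B : ℝ → ℝ → ℝ) (Ψ : ℝ → ℝ → ℂ) (x y : ℝ) : ℂ :=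
  -((S.hbar : ℂ) ^ 2 / 2) * (dx (dx Ψ) x y + dy (dy Ψ) x y)
    - Complex.I * S.hbar / 2 *
      (A x y * dx Ψ x y + dx (fun s t => (A s t : ℂ) * Ψ s t) x y
        + B x y * dy Ψ x y + dy (fun s t => (B s t : ℂ) * Ψ s t) x y)
    + S.V A B x y * Ψ x y

/-- The second order Cartesian integral of motion, acting on wave functions. -/
def X (A B : ℝ → ℝ → ℝ) (Ψ : ℝ → ℝ → ℂ) (x y : ℝ) : ℂ :=
  -((S.hbar : ℂ) ^ 2 / 2) * dx (dx Ψ) x y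
    - Complex.I * S.hbar * ((A x y + S.k₁ x y) * dx Ψ x y + S.k₂ x y * dy Ψ x y)
    + (-(Complex.I * S.hbar / 2) * (dx A x y + dx S.k₁ x y + dy S.k₂ x y)
        + (A x y : ℂ) ^ 2 / 2 + S.m x y + S.k₁ x y * A x y + S.k₂ x y * B x y) * Ψ x y

/-- The equation `{(H - E) + φ (X - lam)} Ψ = 0` separates in Cartesian coordinates: up to a
nowhere vanishing factor `ρ`, the operator is the sum of an ordinary differential operator in `x`
and an ordinary differential operator in `y`, so that for `Ψ = v(x) w(y)` the equation splits
into an equation for `v` and an equation for `w`. -/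
def Separates (E lam : ℝ) (φ A B : ℝ → ℝ → ℝ) : Prop :=
  ∃ (ρ : ℝ → ℝ → ℂ) (a₂ a₁ a₀ b₂ b₁ b₀ : ℝ → ℂ),
    (∀ x ∈ S.I, ∀ y ∈ S.J, ρ x y ≠ 0) ∧
    ∀ v w : ℝ → ℂ, ContDiffOn ℝ 2 v S.I → ContDiffOn ℝ 2 w S.J → ∀ x ∈ S.I, ∀ y ∈ S.J,
      (S.H A B (fun s t => v s * w t) x y - E * (v x * w y))
        + φ x y * (S.X A B (fun s t => v s * w t) x y - lam * (v x * w y))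
      = ρ x y *
        ((a₂ x * deriv (deriv v) x + a₁ x * deriv v x + a₀ x * v x) * w y
          + v x * (b₂ y * deriv (deriv w) y + b₁ y * deriv w y + b₀ y * w y))

/-- The pair `H`, `X` allows quasiseparation of variables in Cartesian coordinates: in some gauge
and for some real function `φ`, the combined equation separates. -/
def Quasiseparates (E lam : ℝ) : Prop :=
  ∃ φ A B : ℝ → ℝ → ℝ, S.IsVectorPotential A B ∧ S.Separates E lam φ A B

/-- The form of `φ`, `A`, `B` depending on constants `k, c₁, c₂, ε₁, ε₂` and functions `τ, η`:
`1 + φ = (ε₁ √(c₁ - 2kf)) / (ε₂ √(c₂ + 2kg)) · √(g'² / f'²)`,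
`A = τ + φ/(1+φ) g'`, `B = η + φ f'`. The two radicands have the same sign (both roots real or
both imaginary), so the quotient of the roots is the real root of the quotient; the formula
for `φ` is required where `f'` and `g'` do not vanish. -/
def StandardForm (k c₁ c₂ ε₁ ε₂ : ℝ) (τ η : ℝ → ℝ) (φ A B : ℝ → ℝ → ℝ) : Prop :=
  ∀ x ∈ S.I, ∀ y ∈ S.J,
    (deriv S.f x ≠ 0 → deriv S.g y ≠ 0 →
      0 < (c₁ - 2 * k * S.f x) * (c₂ + 2 * k * S.g y) ∧
      1 + φ x y = ε₁ / ε₂ * √((c₁ - 2 * k * S.f x) / (c₂ + 2 * k * S.g y))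
        * √(deriv S.g y ^ 2 / deriv S.f x ^ 2)) ∧
    A x y = τ x + φ x y / (1 + φ x y) * deriv S.g y ∧
    B x y = η y + φ x y * deriv S.f x

/-- The cubic `P₃` with `f'² = P₃(f)`. -/
def P₃ (σ₁ : ℝ) : Polynomial ℝ :=
  .C (2 / 3 * S.α) * .X ^ 3 + .C S.β * .X ^ 2 + .C (2 * S.γ) * .X + .C σ₁

/-- The cubic `Q₃` with `g'² = Q₃(g)`. -/
def Q₃ (σ₂ : ℝ) : Polynomial ℝ :=
  .C (-(2 / 3) * S.α) * .X ^ 3 + .C S.δ * .X ^ 2 + .C (2 * S.ξ) * .X + .C σ₂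

end CartesianSystem

/-- Labels of the rows of the two tables. -/
inductive Row
  | one | two | three | four

/-- `ω = √(√D / 4)`, so that `ω² = √D / 4`, for a discriminant `D`. -/
def omega (D : ℝ) : ℝ := √(√D / 4)

/-- The distance `6 ω² / α` between the simple and the double root. -/
def width (α D : ℝ) : ℝ := 6 * omega D ^ 2 / α

/-- The solutions `F₁, …, F₄` (for `α > 0`), with `D = β² - 4αγ`. -/
def tableF (r : Row) (α β γ x₀ x : ℝ) : ℝ :=
  let D := β ^ 2 - 4 * α * γ
  match r with
  | .one => 6 / (α * (x - x₀) ^ 2) - β / (2 * α)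
  | .two => (-β - √D) / (2 * α) + width α D / Real.sin (omega D * (x - x₀)) ^ 2
  | .three => (-β + √D) / (2 * α) - width α D
      + width α D * Real.tanh (omega D * (x - x₀)) ^ 2
  | .four => (-β + √D) / (2 * α) - width α D
      + width α D / Real.tanh (omega D * (x - x₀)) ^ 2

/-- The simple root of `P₃` (the triple one in the first row) for `F₁, …, F₄` (for `α > 0`). -/
def tableFRoot (r : Row) (α β γ : ℝ) : ℝ :=
  let D := β ^ 2 - 4 * α * γ
  match r with
  | .one => -β / (2 * α)
  | .two => (-β - √D) / (2 * α) + width α D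
  | .three => (-β + √D) / (2 * α) - width α D
  | .four => (-β + √D) / (2 * α) - width α D

/-- The solutions `G₁, …, G₄` (for `α > 0`), with `D = δ² + 4αξ`. -/
def tableG (r : Row) (α δ ξ y₀ y : ℝ) : ℝ :=
  let D := δ ^ 2 + 4 * α * ξ
  match r with
  | .one => δ / (2 * α) - 6 / (α * (y - y₀) ^ 2)
  | .two => (δ - √D) / (2 * α) + width α D
      - width α D / Real.tanh (omega D * (y - y₀)) ^ 2
  | .three => (δ - √D) / (2 * α) + width α D
      - width α D * Real.tanh (omega D * (y - y₀)) ^ 2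
  | .four => (δ + √D) / (2 * α) - width α D / Real.sin (omega D * (y - y₀)) ^ 2

/-- The simple root of `Q₃` (the triple one in the first row) for `G₁, …, G₄` (for `α > 0`). -/
def tableGRoot (r : Row) (α δ ξ : ℝ) : ℝ :=
  let D := δ ^ 2 + 4 * α * ξ
  match r with
  | .one => δ / (2 * α)
  | .two => (δ - √D) / (2 * α) + width α D
  | .three => (δ - √D) / (2 * α) + width α D
  | .four => (δ + √D) / (2 * α) - width α D

/-- The point `x` is not a pole of the solution `F_r` centred at `x₀`. -/
def regularF (r : Row) (D x₀ x : ℝ) : Prop :=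
  match r with
  | .one => x ≠ x₀
  | .two => Real.sin (omega D * (x - x₀)) ≠ 0
  | .three => True
  | .four => x ≠ x₀

/-- The point `y` is not a pole of the solution `G_r` centred at `y₀`. -/
def regularG (r : Row) (D y₀ y : ℝ) : Prop :=
  match r with
  | .one => y ≠ y₀
  | .two => y ≠ y₀
  | .three => True
  | .four => Real.sin (omega D * (y - y₀)) ≠ 0

namespace CartesianSystem

variable (S : CartesianSystem)

/-- `f` is the solution `F_r`; for `α < 0` this means that `-f`, which solves the equation with
constants `-α, β, -γ`, is the solution `F_r` for these constants. -/
def IsTableF (r : Row) : Prop :=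
  let D := S.β ^ 2 - 4 * S.α * S.γ
  (r ≠ .one → 0 < D) ∧
  ((0 < S.α ∧ ∃ x₀, ∀ x ∈ S.I, regularF r D x₀ x ∧ S.f x = tableF r S.α S.β S.γ x₀ x) ∨
   (S.α < 0 ∧ ∃ x₀, ∀ x ∈ S.I, regularF r D x₀ x ∧ -S.f x = tableF r (-S.α) S.β (-S.γ) x₀ x))

/-- `g` is the solution `G_r`; for `α < 0` this means that `-g`, which solves the equation with
constants `-α, δ, -ξ`, is the solution `G_r` for these constants. -/
def IsTableG (r : Row) : Prop :=
  let D := S.δ ^ 2 + 4 * S.α * S.ξ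
  (r ≠ .one → 0 < D) ∧
  ((0 < S.α ∧ ∃ y₀, ∀ y ∈ S.J, regularG r D y₀ y ∧ S.g y = tableG r S.α S.δ S.ξ y₀ y) ∨
   (S.α < 0 ∧ ∃ y₀, ∀ y ∈ S.J, regularG r D y₀ y ∧ -S.g y = tableG r (-S.α) S.δ (-S.ξ) y₀ y))

/-- The value of `c₁` in row `r` of the first table. -/
def tableC₁ (r : Row) (k : ℝ) : ℝ :=
  if 0 < S.α then 2 * k * tableFRoot r S.α S.β S.γ
  else -(2 * k * tableFRoot r (-S.α) S.β (-S.γ))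

/-- The value of `c₂` in row `r` of the second table. -/
def tableC₂ (r : Row) (k : ℝ) : ℝ :=
  if 0 < S.α then -(2 * k * tableGRoot r S.α S.δ S.ξ)
  else 2 * k * tableGRoot r (-S.α) S.δ (-S.ξ)

def Case1 : Prop :=
  S.α = 0 ∧ S.δ = 0 ∧ S.ξ = 0 ∧ ∃ g₀ g₁ : ℝ, ∀ y ∈ S.J, S.g y = g₀ * y + g₁

def Case2 : Prop :=
  S.α = 0 ∧ 0 < S.δ ∧ ∃ g₁ g₂ : ℝ, g₁ * g₂ = 0 ∧
    ∀ y ∈ S.J, S.g y = g₁ * Real.exp (√S.δ * y) + g₂ * Real.exp (-√S.δ * y) - S.ξ / S.δ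

/-- `f` and `g` are the quadratic solutions, with `x₀, y₀` the origin and `f₀, g₀` the additive
constants (which can be normalized to zero). -/
def IsQuadratic (x₀ y₀ f₀ g₀ : ℝ) : Prop :=
  (∀ x ∈ S.I, S.f x = S.γ / 2 * (x - x₀) ^ 2 + f₀) ∧
  (∀ y ∈ S.J, S.g y = S.ξ / 2 * (y - y₀) ^ 2 + g₀)

def Case3 : Prop :=
  S.α = 0 ∧ S.β = 0 ∧ S.δ = 0 ∧ S.ξ * S.γ < 0 ∧ ∃ x₀ y₀ f₀ g₀ : ℝ, S.IsQuadratic x₀ y₀ f₀ g₀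

def Case4 : Prop :=
  S.α ≠ 0 ∧ ∃ r s : Row, S.IsTableF r ∧ S.IsTableG s

end CartesianSystem

/-- `ε` is a sign. -/
def IsSign (ε : ℝ) : Prop := ε = 1 ∨ ε = -1

/-- The relation between the signs for the pair `(F_r, G_s)`: `ε₁ = ε₂` for
`(F₁,G₃), (F₂,G₃), (F₄,G₃), (F₃,G₁), (F₃,G₂), (F₃,G₄)`, and `ε₁ = -ε₂` for the other ten pairs. -/
def SignRelation (r s : Row) (ε₁ ε₂ : ℝ) : Prop :=
  match r, s with
  | .three, .three => ε₁ = -ε₂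
  | .three, _ => ε₁ = ε₂
  | _, .three => ε₁ = ε₂
  | _, _ => ε₁ = -ε₂

end

/-! Applied to a product `v w`, the combined operator has five coefficients, and separation
prescribes the form of each up to the common factor ρ (`separates_iff`). The coefficient of w'' is
constant, so ρ depends on y only. Its phase turns out to be constant, and taking real parts gives 1
+ φ = p(x) q(y) with real p, q (`Separates.exists_realForm`). The first order coefficients say that
(1 + φ)A - φ g' is q times a function of x and that B - φ f' is a function of y.

Put P = p f' and Q = g'/q. The equation A_y - B_x = Ω becomes p P' = -k, Q' = k q with one constant
k, hence P² = c₁ - 2kf and Q² = c₂ + 2kg. Completing squares in the zeroth order coefficient and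
dividing by q leaves functions of one variable plus f u(y) + g w(x), where u = g''/q + kq and w = p
f'' - k/p (`zerothOrder_eq`). For nonconstant f, g this is a sum of a function of x and a function
of y exactly when u is affine in g and w is affine in f with opposite slopes. Both variables thus
carry the same structure, `SideData`; for g it is used with 1/q in place of p and with opposite
signs of α, k and the slope.

Multiplying the affine relation by f' and integrating gives p f'² = S(f) with S of degree at most
two. Then S(t)² = (c - 2kt) P₃(t) holds at infinitely many t, hence as polynomials
(`SideData.exists_coeffs`). If α ≠ 0, the root t₁ of the linear factor is also a root of S, so P₃ is
a multiple of (t - t₁)(t - t₂)². This excludes elliptic functions. Moreover p is a multiple of 1/(f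
- t₂), so 1 + φ = (g - s₂)/(f - t₂), and a multiple U of P solves the Riccati equation U' = t₁ - t₂
+ (α/6)U², whose solutions are the table rows. If α = 0, then k = 0 makes g' affine in g (cases 1
and 2), and k ≠ 0 gives case 3. The degenerate possibility P ≡ 0, where φ = -1 off the zeros of f',
also makes g' affine in g (`RealForm.exists_linear`).

Conversely the same identities can be read backwards (`separates_of_factors`). The only additional
requirement is on the imaginary divergence term: it suffices that (p'/p)Q + (q'/q)P = 0. For p =
1/(f - t₂), q = g - s₂ this holds because p'/p = -P and q'/q = Q. -/

noncomputable section

/-! ### The separation conditions, coefficient by coefficient -/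

namespace CartesianSystem

variable (S : CartesianSystem)

/-- The zeroth order term of the combined operator, up to the imaginary divergence term. -/
def zerothOrder (A B : ℝ → ℝ → ℝ) (E lam φ x y : ℝ) : ℝ :=
  S.V A B x y - E + φ * (A x y ^ 2 / 2 + S.m x y - deriv S.g y * A x y
    - deriv S.f x * B x y - lam)

theorem IsVectorPotential.differentiableAt {S : CartesianSystem} {A B : ℝ → ℝ → ℝ}
    (h : S.IsVectorPotential A B) {x y : ℝ} (hx : x ∈ S.I) (hy : y ∈ S.J) :
    DifferentiableAt ℝ (fun s => A s y) x ∧ DifferentiableAt ℝ (fun s => A x s) y ∧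
      DifferentiableAt ℝ (fun s => B s y) x ∧ DifferentiableAt ℝ (fun s => B x s) y := by
  have hn : S.I ×ˢ S.J ∈ nhds (x, y) := (S.I_open.prod S.J_open).mem_nhds ⟨hx, hy⟩
  have hA := (h.1.contDiffAt hn).differentiableAt (by simp)
  have hB := (h.2.1.contDiffAt hn).differentiableAt (by simp)
  have e1 : DifferentiableAt ℝ (fun s : ℝ => (s, y)) x := by fun_prop
  have e2 : DifferentiableAt ℝ (fun s : ℝ => (x, s)) y := by fun_prop
  exact ⟨DifferentiableAt.comp (g := Function.uncurry A) x hA e1,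
    DifferentiableAt.comp (g := Function.uncurry A) y hA e2,
    DifferentiableAt.comp (g := Function.uncurry B) x hB e1,
    DifferentiableAt.comp (g := Function.uncurry B) y hB e2⟩

/-- Since k₁ depends on y only and k₂ on x only, they have no divergence. The zeroth order
coefficient therefore has a real part `zerothOrder` and an imaginary part proportional to (1 + φ)A_x
+ B_y. -/
theorem combined_apply {A B : ℝ → ℝ → ℝ} {x y : ℝ}
    (hA : DifferentiableAt ℝ (fun s => A s y) x) (hB : DifferentiableAt ℝ (fun s => B x s) y)
    {v w : ℝ → ℂ} (hv : DifferentiableAt ℝ v x) (hw : DifferentiableAt ℝ w y) (E lam φ : ℝ) :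
    (S.H A B (fun s t => v s * w t) x y - E * (v x * w y))
        + φ * (S.X A B (fun s t => v s * w t) x y - lam * (v x * w y))
      = -((S.hbar : ℂ) ^ 2 / 2) *
          ((1 + φ) * deriv (deriv v) x * w y + v x * deriv (deriv w) y)
        - Complex.I * S.hbar * (((1 + φ) * A x y - φ * deriv S.g y) * deriv v x * w y
          + (B x y - φ * deriv S.f x) * v x * deriv w y)
        + (-(Complex.I * S.hbar / 2) * ((1 + φ) * (dx A x y : ℝ) + (dy B x y : ℝ))
          + S.zerothOrder A B E lam φ x y) * (v x * w y) := by
  have h1 : ∀ u : ℝ → ℂ, ∀ c : ℂ, deriv (fun s => u s * c) = fun s => deriv u s * c := by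
    intro u c; funext s; exact deriv_mul_const_field c
  have h2 : ∀ u : ℝ → ℂ, ∀ c : ℂ, deriv (fun s => c * u s) = fun s => c * deriv u s := by
    intro u c; funext s; exact deriv_const_mul_field c
  have h3 : deriv (fun s => (A s y : ℂ) * (v s * w y)) x
      = ((dx A x y : ℝ) : ℂ) * (v x * w y) + A x y * (deriv v x * w y) :=
    (hA.hasDerivAt.ofReal_comp.mul (hv.hasDerivAt.mul_const (w y))).deriv
  have h4 : deriv (fun s => (B x s : ℂ) * (v x * w s)) y
      = ((dy B x y : ℝ) : ℂ) * (v x * w y) + B x y * (v x * deriv w y) :=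
    (hB.hasDerivAt.ofReal_comp.mul (hw.hasDerivAt.const_mul (v x))).deriv
  have h5 : dx S.k₁ x y = 0 := by simp [dx, k₁]
  have h6 : dy S.k₂ x y = 0 := by simp [dy, k₂]
  have h7 : dx (dx fun s t => v s * w t) x y = deriv (deriv v) x * w y := by
    simp only [dx, h1]
  have h8 : dy (dy fun s t => v s * w t) x y = v x * deriv (deriv w) y := by
    simp only [dy, h2]
  have h9 : dx (fun s t => v s * w t) x y = deriv v x * w y := by
    simp only [dx, h1]
  have h10 : dy (fun s t => v s * w t) x y = v x * deriv w y := by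
    simp only [dy, h2]
  have h11 : dx (fun s t => (A s t : ℂ) * (v s * w t)) x y
      = ((dx A x y : ℝ) : ℂ) * (v x * w y) + A x y * (deriv v x * w y) := h3
  have h12 : dy (fun s t => (B s t : ℂ) * (v s * w t)) x y
      = ((dy B x y : ℝ) : ℂ) * (v x * w y) + B x y * (v x * deriv w y) := h4
  simp only [H, X, h5, h6, h7, h8, h9, h10, h11, h12, zerothOrder, k₁, k₂]
  push_cast
  ring

/-- The functions 1, s - x, (s - x)² centred at the point under consideration have independent
2-jets, so testing with them in each variable isolates every coefficient. -/
theorem separates_iff {A B : ℝ → ℝ → ℝ} (h : S.IsVectorPotential A B) (E lam : ℝ)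
    (φ : ℝ → ℝ → ℝ) :
    S.Separates E lam φ A B ↔
      ∃ (ρ : ℝ → ℝ → ℂ) (a₂ a₁ a₀ b₂ b₁ b₀ : ℝ → ℂ),
        (∀ x ∈ S.I, ∀ y ∈ S.J, ρ x y ≠ 0) ∧ ∀ x ∈ S.I, ∀ y ∈ S.J,
          -((S.hbar : ℂ) ^ 2 / 2) * (1 + φ x y) = ρ x y * a₂ x ∧
          -((S.hbar : ℂ) ^ 2 / 2) = ρ x y * b₂ y ∧
          -(Complex.I * S.hbar) * ((1 + φ x y) * A x y - φ x y * deriv S.g y)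
            = ρ x y * a₁ x ∧
          -(Complex.I * S.hbar) * (B x y - φ x y * deriv S.f x) = ρ x y * b₁ y ∧
          -(Complex.I * S.hbar / 2) * ((1 + φ x y) * dx A x y + dy B x y)
            + S.zerothOrder A B E lam (φ x y) x y = ρ x y * (a₀ x + b₀ y) := by
  constructor
  · rintro ⟨ρ, a₂, a₁, a₀, b₂, b₁, b₀, hρ, hs⟩
    refine ⟨ρ, a₂, a₁, a₀, b₂, b₁, b₀, hρ, fun x hx y hy => ?_⟩
    have key : ∀ v w : ℝ → ℂ, ContDiff ℝ 2 v → ContDiff ℝ 2 w → _ := fun v w hv hw =>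
      (S.combined_apply (h.differentiableAt hx hy).1 (h.differentiableAt hx hy).2.2.2
        (hv.differentiable (by simp) x) (hw.differentiable (by simp) y) E lam (φ x y)).symm.trans
        (hs v w hv.contDiffOn hw.contDiffOn x hx y hy)
    have c1 : ContDiff ℝ 2 (fun _ : ℝ => (1 : ℂ)) := contDiff_const
    have l1 : ∀ c : ℝ, ContDiff ℝ 2 (fun s : ℝ => ((s : ℂ) - (c : ℂ))) := fun c =>
      Complex.ofRealCLM.contDiff.sub contDiff_const
    have q1 : ∀ c : ℝ, ContDiff ℝ 2 (fun s : ℝ => ((s : ℂ) - (c : ℂ)) ^ 2) := fun c =>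
      (l1 c).pow 2
    have dl : ∀ c s : ℝ, HasDerivAt (fun s : ℝ => ((s : ℂ) - (c : ℂ))) 1 s := fun c s => by
      simpa using (hasDerivAt_id s).ofReal_comp.sub_const (c : ℂ)
    have d1 : ∀ c : ℝ, deriv (fun s : ℝ => ((s : ℂ) - (c : ℂ))) = fun _ => 1 := fun c => by
      funext s; exact (dl c s).deriv
    have d2 : ∀ c : ℝ, deriv (fun s : ℝ => ((s : ℂ) - (c : ℂ)) ^ 2)
        = fun s : ℝ => 2 * ((s : ℂ) - (c : ℂ)) := fun c => by
      funext s; simpa using ((dl c s).fun_pow 2).deriv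
    have d3 : ∀ c s : ℝ, deriv (fun s : ℝ => 2 * ((s : ℂ) - (c : ℂ))) s = 2 := fun c s => by
      simpa using ((dl c s).const_mul 2).deriv
    have k0 := key _ _ c1 c1
    have k1 := key _ _ (l1 x) c1
    have k2 := key _ _ (q1 x) c1
    have k3 := key _ _ c1 (l1 y)
    have k4 := key _ _ c1 (q1 y)
    simp only [d1, d2, d3, deriv_const', sub_self] at k0 k1 k2 k3 k4
    refine ⟨?_, ?_, ?_, ?_, ?_⟩
    · linear_combination k2 / 2
    · linear_combination k4 / 2
    · linear_combination k1
    · linear_combination k3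
    · linear_combination k0
  · rintro ⟨ρ, a₂, a₁, a₀, b₂, b₁, b₀, hρ, hs⟩
    refine ⟨ρ, a₂, a₁, a₀, b₂, b₁, b₀, hρ, fun v w hv hw x hx y hy => ?_⟩
    have hv' : DifferentiableAt ℝ v x :=
      (hv.contDiffAt (S.I_open.mem_nhds hx)).differentiableAt (by simp)
    have hw' : DifferentiableAt ℝ w y :=
      (hw.contDiffAt (S.J_open.mem_nhds hy)).differentiableAt (by simp)
    rw [S.combined_apply (h.differentiableAt hx hy).1 (h.differentiableAt hx hy).2.2.2 hv' hw']
    obtain ⟨e1, e2, e3, e4, e5⟩ := hs x hx y hy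
    linear_combination deriv (deriv v) x * w y * e1 + v x * deriv (deriv w) y * e2
      + deriv v x * w y * e3 + v x * deriv w y * e4 + v x * w y * e5

end CartesianSystem

/-! ### Constancy and polynomial identities on an interval -/

section Interval

variable {I : Set ℝ}

theorem eq_of_hasDerivAt_zero (hI : IsOpen I) (hc : I.OrdConnected) {F : ℝ → ℝ}
    (h : ∀ x ∈ I, HasDerivAt F 0 x) : ∀ x ∈ I, ∀ y ∈ I, F x = F y := by
  intro x hx y hy
  exact hI.is_const_of_deriv_eq_zero hc.isPreconnected
    (fun z hz => (h z hz).differentiableAt.differentiableWithinAt)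
    (fun z hz => (h z hz).deriv) hx hy

theorem exists_eq_const (hI : IsOpen I) (hc : I.OrdConnected) {F : ℝ → ℝ}
    (h : ∀ x ∈ I, HasDerivAt F 0 x) : ∃ c, ∀ x ∈ I, F x = c := by
  rcases I.eq_empty_or_nonempty with rfl | ⟨x₀, hx₀⟩
  · exact ⟨0, by simp⟩
  · exact ⟨F x₀, fun x hx => eq_of_hasDerivAt_zero hI hc h x hx x₀ hx₀⟩

/-- A nonconstant continuous function on an interval satisfies no polynomial identity. -/
theorem coeffs_eq_zero (hc : I.OrdConnected) {f : ℝ → ℝ} (hf : ContinuousOn f I)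
    (hn : ¬ ∃ c, ∀ x ∈ I, f x = c) {a₄ a₃ a₂ a₁ a₀ : ℝ}
    (h : ∀ x ∈ I, a₄ * f x ^ 4 + a₃ * f x ^ 3 + a₂ * f x ^ 2 + a₁ * f x + a₀ = 0) :
    a₄ = 0 ∧ a₃ = 0 ∧ a₂ = 0 ∧ a₁ = 0 ∧ a₀ = 0 := by
  have hnt : (f '' I).Nontrivial := by
    by_contra hs
    rw [Set.not_nontrivial_iff] at hs
    apply hn
    rcases I.eq_empty_or_nonempty with rfl | ⟨x₀, hx₀⟩
    · exact ⟨0, by simp⟩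
    · exact ⟨f x₀, fun x hx => hs ⟨x, hx, rfl⟩ ⟨x₀, hx₀, rfl⟩⟩
  -- The image of the interval is connected with more than one point, hence infinite: too many roots
  -- for a nonzero polynomial.
  have hinf := (hc.isPreconnected.image f hf).infinite_of_nontrivial hnt
  set p : Polynomial ℝ := .C a₄ * .X ^ 4 + .C a₃ * .X ^ 3 + .C a₂ * .X ^ 2 + .C a₁ * .X + .C a₀
    with hp
  have hp0 : p = 0 := by
    apply Polynomial.eq_zero_of_infinite_isRoot
    refine hinf.mono ?_
    rintro _ ⟨x, hx, rfl⟩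
    simpa [hp, Polynomial.IsRoot] using h x hx
  have hk : ∀ n, p.coeff n = 0 := fun n => by rw [hp0]; simp
  have e0 := hk 0
  have e1 := hk 1
  have e2 := hk 2
  have e3 := hk 3
  have e4 := hk 4
  simp [hp, Polynomial.coeff_X, Polynomial.coeff_C, Polynomial.coeff_X_pow] at e0 e1 e2 e3 e4
  exact ⟨e4, e3, e2, e1, e0⟩

end Interval

/-! ### The equation f'' = α f² + β f + γ -/

/-- `f` is a `C²` solution of `f'' = α f² + β f + γ` on the open interval `I`. -/
structure QuadraticODE (I : Set ℝ) (α β γ : ℝ) (f : ℝ → ℝ) : Prop where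
  isOpen : IsOpen I
  ordConnected : I.OrdConnected
  contDiffOn : ContDiffOn ℝ 2 f I
  ode : ∀ x ∈ I, deriv (deriv f) x = α * f x ^ 2 + β * f x + γ

namespace QuadraticODE

variable {I : Set ℝ} {α β γ : ℝ} {f : ℝ → ℝ}

theorem contDiffOn_deriv (h : QuadraticODE I α β γ f) : ContDiffOn ℝ 1 (deriv f) I :=
  ((contDiffOn_succ_iff_deriv_of_isOpen (n := 1) h.isOpen).1 h.contDiffOn).2.2

theorem hasDerivAt (h : QuadraticODE I α β γ f) {x : ℝ} (hx : x ∈ I) :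
    HasDerivAt f (deriv f x) x :=
  ((h.contDiffOn.contDiffAt (h.isOpen.mem_nhds hx)).differentiableAt (by simp)).hasDerivAt

theorem hasDerivAt_deriv (h : QuadraticODE I α β γ f) {x : ℝ} (hx : x ∈ I) :
    HasDerivAt (deriv f) (α * f x ^ 2 + β * f x + γ) x := by
  rw [← h.ode x hx]
  exact ((h.contDiffOn_deriv.contDiffAt (h.isOpen.mem_nhds hx)).differentiableAt
    (by simp)).hasDerivAt

/-- Bootstrapping: the right side of the equation is a polynomial in f, so the regularity of f
passes to f''. The induction carries f and f' together. -/
theorem smooth (h : QuadraticODE I α β γ f) : ContDiffOn ℝ ∞ f I := by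
  have key : ∀ n : ℕ, ContDiffOn ℝ n f I ∧ ContDiffOn ℝ n (deriv f) I := by
    intro n
    induction n with
    | zero => exact ⟨h.contDiffOn.of_le (by simp), h.contDiffOn_deriv.of_le (by simp)⟩
    | succ n ih =>
      have h2 : ContDiffOn ℝ n (deriv (deriv f)) I := by
        refine ContDiffOn.congr ?_ h.ode
        exact ((contDiffOn_const.mul (ih.1.pow 2)).add (contDiffOn_const.mul ih.1)).add
          contDiffOn_const
      push_cast
      rw [contDiffOn_succ_iff_deriv_of_isOpen h.isOpen,
        contDiffOn_succ_iff_deriv_of_isOpen h.isOpen]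
      exact ⟨⟨fun x hx => (h.hasDerivAt hx).differentiableAt.differentiableWithinAt,
        by simp, ih.2⟩, fun x hx =>
          (h.hasDerivAt_deriv hx).differentiableAt.differentiableWithinAt, by simp, h2⟩
  exact contDiffOn_infty.2 fun n => (key n).1

theorem smooth_deriv (h : QuadraticODE I α β γ f) : ContDiffOn ℝ ∞ (deriv f) I :=
  ((contDiffOn_infty_iff_deriv_of_isOpen h.isOpen).1 h.smooth).2

theorem continuousOn (h : QuadraticODE I α β γ f) : ContinuousOn f I :=
  h.contDiffOn.continuousOn

theorem exists_first_integral (h : QuadraticODE I α β γ f) :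
    ∃ σ, ∀ x ∈ I, deriv f x ^ 2 = 2 / 3 * α * f x ^ 3 + β * f x ^ 2 + 2 * γ * f x + σ := by
  obtain ⟨σ, hσ⟩ := exists_eq_const h.isOpen h.ordConnected
    (F := fun x => deriv f x ^ 2 - (2 / 3 * α * f x ^ 3 + β * f x ^ 2 + 2 * γ * f x))
    (fun x hx => by
      have h1 := h.hasDerivAt hx
      have h2 := h.hasDerivAt_deriv hx
      refine ((h2.fun_pow 2).sub ((((h1.fun_pow 3).const_mul (2 / 3 * α)).add
        ((h1.fun_pow 2).const_mul β)).add (h1.const_mul (2 * γ)))).congr_deriv ?_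
      norm_num
      ring)
  exact ⟨σ, fun x hx => by linarith [hσ x hx]⟩

/-- A nonconstant solution takes two different values at points where `f' ≠ 0`. -/
theorem exists_ne (h : QuadraticODE I α β γ f) (hn : ¬ ∃ c, ∀ x ∈ I, f x = c) :
    ∃ x₁ ∈ I, ∃ x₂ ∈ I, deriv f x₁ ≠ 0 ∧ deriv f x₂ ≠ 0 ∧ f x₁ ≠ f x₂ := by
  obtain ⟨x₁, hx₁, h1⟩ : ∃ x ∈ I, deriv f x ≠ 0 := by
    by_contra! h0
    exact hn (exists_eq_const h.isOpen h.ordConnected fun x hx => h0 x hx ▸ h.hasDerivAt hx)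
  -- By continuity f' stays nonzero near x₁, and the nonzero derivative at x₁ keeps f off the value
  -- f(x₁) on a punctured neighbourhood.
  have hn1 : ∀ᶠ x in nhds x₁, x ∈ I ∧ deriv f x ≠ 0 :=
    (h.isOpen.eventually_mem hx₁).and ((h.hasDerivAt_deriv hx₁).continuousAt.eventually_ne h1)
  have hn2 : ∀ᶠ x in nhdsWithin x₁ {x₁}ᶜ, f x ≠ f x₁ := (h.hasDerivAt hx₁).eventually_ne h1
  obtain ⟨x₂, ⟨h2, h3⟩, h4⟩ := ((hn1.filter_mono nhdsWithin_le_nhds).and hn2).exists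
  exact ⟨x₁, hx₁, x₂, h2, h1, h3, h4.symm⟩

end QuadraticODE

namespace CartesianSystem

variable (S : CartesianSystem)

theorem odeF : QuadraticODE S.I S.α S.β S.γ S.f :=
  ⟨S.I_open, S.I_interval, S.f_contDiff, S.f_ode⟩

theorem odeG : QuadraticODE S.J (-S.α) S.δ S.ξ S.g :=
  ⟨S.J_open, S.J_interval, S.g_contDiff, S.g_ode⟩

end CartesianSystem

/-! ### The zeroth order term and the real form of the separation conditions -/

namespace CartesianSystem

variable (S : CartesianSystem)

/-- The part of the zeroth order term that depends on `x` only. -/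
def restX (c₂ σ₂ lam p τ x : ℝ) : ℝ :=
  p * τ ^ 2 / 2 + p * deriv S.f x ^ 2 - c₂ / (2 * p)
    + p * (-(2 / 3) * S.α * S.f x ^ 3 - S.β * S.f x ^ 2 - S.δ / 2 * S.f x ^ 2
      - 2 * S.γ * S.f x + S.μ * S.f x - σ₂ / 2) - lam * p

/-- The potential part of the zeroth order term that depends on `y` only. -/
def potentialY (σ₁ E lam η y : ℝ) : ℝ :=
  η ^ 2 / 2 + deriv S.g y ^ 2 + 2 / 3 * S.α * S.g y ^ 3 - S.β / 2 * S.g y ^ 2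
    - S.δ * S.g y ^ 2 - 2 * S.ξ * S.g y - S.μ * S.g y - σ₁ / 2 - E + lam

/-- For φ = -1 the terms A²/2 cancel, and B²/2 + f'B = (η² - f'²)/2. The first integral of f absorbs
f'², so the only mixed products left are f g'' and g'τ. -/
theorem zerothOrder_neg_one {A B : ℝ → ℝ → ℝ} {σ₁ E lam τ η x y : ℝ}
    (hf : deriv S.f x ^ 2
      = 2 / 3 * S.α * S.f x ^ 3 + S.β * S.f x ^ 2 + 2 * S.γ * S.f x + σ₁)
    (hA : A x y = deriv S.g y + τ) (hB : B x y = -deriv S.f x + η) :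
    S.zerothOrder A B E lam (-1) x y
      = S.f x * (-S.α * S.g y ^ 2 + S.δ * S.g y + S.ξ) + deriv S.g y * τ
        + S.potentialY σ₁ E lam η y := by
  simp only [zerothOrder, V, W, m, potentialY, hA, hB]
  linear_combination -(1 / 2) * hf

/-- Completing squares in A and B turns the gauge terms into pqτ²/2 + η²/2 - (φ²/2)(g'²/(pq) + f'²).
Expanding φ² = (pq - 1)², the parts that mix the variables after division by q are -Q²/(2p) and
-qP²/2 with P = p f', Q = g'/q. As P² and Q² are affine in f and g, they contribute exactly the
products -(k/p) g and kq f. -/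
theorem zerothOrder_eq {A B : ℝ → ℝ → ℝ} {σ₁ σ₂ c₁ c₂ k E lam p q τ η x y : ℝ}
    (hp : p ≠ 0) (hq : q ≠ 0)
    (hf : deriv S.f x ^ 2
      = 2 / 3 * S.α * S.f x ^ 3 + S.β * S.f x ^ 2 + 2 * S.γ * S.f x + σ₁)
    (hg : deriv S.g y ^ 2
      = 2 / 3 * (-S.α) * S.g y ^ 3 + S.δ * S.g y ^ 2 + 2 * S.ξ * S.g y + σ₂)
    (hP : (p * deriv S.f x) ^ 2 = c₁ - 2 * k * S.f x)
    (hQ : (deriv S.g y / q) ^ 2 = c₂ + 2 * k * S.g y)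
    (hA : A x y = τ + deriv S.g y - deriv S.g y / q / p)
    (hB : B x y = η + (p * q - 1) * deriv S.f x) :
    S.zerothOrder A B E lam (p * q - 1) x y
      = q * (S.f x * ((-S.α * S.g y ^ 2 + S.δ * S.g y + S.ξ) / q + k * q)
        + S.g y * (p * (S.α * S.f x ^ 2 + S.β * S.f x + S.γ) - k / p)
        + S.restX c₂ σ₂ lam p τ x + (S.potentialY σ₁ E lam η y / q - c₁ * q / 2)) := by
  obtain ⟨s, hs⟩ : ∃ s, s = deriv S.g y / q := ⟨_, rfl⟩
  have hgs : deriv S.g y = s * q := by rw [hs]; field_simp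
  rw [← hs] at hQ hA
  -- The first integrals isolate a single mixed product in each potential: g f'' in m, and f g'' in
  -- W - m.
  have hm : S.m x y = (-(2 / 3) * S.α * S.f x ^ 3 - S.β * S.f x ^ 2 - S.δ / 2 * S.f x ^ 2
      - 2 * S.γ * S.f x + S.μ * S.f x) + S.g y * (S.α * S.f x ^ 2 + S.β * S.f x + S.γ)
      + deriv S.g y ^ 2 / 2 - σ₂ / 2 := by
    simp only [m]
    linear_combination -(1 / 2) * hg
  have hW : S.W x y = S.m x y + deriv S.f x ^ 2 / 2 - σ₁ / 2
      + S.f x * (-S.α * S.g y ^ 2 + S.δ * S.g y + S.ξ) + (2 / 3 * S.α * S.g y ^ 3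
      - S.β / 2 * S.g y ^ 2 - S.δ * S.g y ^ 2 - 2 * S.ξ * S.g y - S.μ * S.g y) := by
    simp only [m, W]
    linear_combination -(1 / 2) * hf
  have hc1 : c₁ = (p * deriv S.f x) ^ 2 + 2 * k * S.f x := by linarith
  have hc2 : c₂ = s ^ 2 - 2 * k * S.g y := by linarith
  simp only [zerothOrder, V, hW, hm, hA, hB, restX, potentialY, hc1, hc2]
  rw [hgs]
  field_simp
  ring

/-- A real normal form of the separation conditions. -/
structure RealForm (E lam : ℝ) (φ A B : ℝ → ℝ → ℝ) (p q a r η t : ℝ → ℝ) : Prop where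
  ne_zero : ∀ y ∈ S.J, q y ≠ 0
  eq_phi : ∀ x ∈ S.I, ∀ y ∈ S.J, φ x y = p x * q y - 1
  eq_A : ∀ x ∈ S.I, ∀ y ∈ S.J, (1 + φ x y) * A x y - φ x y * deriv S.g y = q y * a x
  eq_B : ∀ x ∈ S.I, ∀ y ∈ S.J, B x y = η y + φ x y * deriv S.f x
  eq_zeroth : ∀ x ∈ S.I, ∀ y ∈ S.J, S.zerothOrder A B E lam (φ x y) x y = q y * (r x + t y)

theorem exists_deriv_ne_zero {I : Set ℝ} {α β γ : ℝ} {f : ℝ → ℝ} (h : QuadraticODE I α β γ f)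
    (hn : ¬ ∃ c, ∀ x ∈ I, f x = c) : ∃ x ∈ I, deriv f x ≠ 0 := by
  obtain ⟨x, hx, -, -, h1, -⟩ := h.exists_ne hn
  exact ⟨x, hx, h1⟩

/-- The constant w'' coefficient makes ρ a function of y. Some other coefficient is a nonzero real
function times a constant, so ρ = qζ with q real and ζ a complex constant. The real parts of the
conditions then form the real system, and the divergence term drops out because it is purely
imaginary. -/
theorem Separates.exists_realForm {S : CartesianSystem} {E lam : ℝ} {φ A B : ℝ → ℝ → ℝ}
    (hv : S.IsVectorPotential A B) (hs : S.Separates E lam φ A B)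
    (hg : ¬ ∃ c, ∀ y ∈ S.J, S.g y = c) : ∃ p q a r η t, S.RealForm E lam φ A B p q a r η t := by
  obtain ⟨ρ, a₂, a₁, a₀, b₂, b₁, b₀, hρ, h⟩ := (S.separates_iff hv E lam φ).1 hs
  obtain ⟨x₀, hx₀⟩ := S.I_nonempty
  have hh : (S.hbar : ℂ) ≠ 0 := by exact_mod_cast S.hbar_pos.ne'
  have hb : ∀ x ∈ S.I, ∀ y ∈ S.J, b₂ y ≠ 0 := fun x hx y hy hb0 => by
    have := (h x hx y hy).2.1
    rw [hb0, mul_zero] at this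
    exact hh (by simpa using this)
  have hρx : ∀ x ∈ S.I, ∀ x' ∈ S.I, ∀ y ∈ S.J, ρ x y = ρ x' y := fun x hx x' hx' y hy =>
    mul_right_cancel₀ (hb x hx y hy) ((h x hx y hy).2.1.symm.trans (h x' hx' y hy).2.1)
  obtain ⟨ζ, q, hζ⟩ : ∃ (ζ : ℂ) (q : ℝ → ℝ), ∀ x ∈ S.I, ∀ y ∈ S.J, ρ x y = q y * ζ := by
    by_cases ha : ∃ x ∈ S.I, a₂ x ≠ 0
    · obtain ⟨x₁, hx₁, ha⟩ := ha
      refine ⟨-((S.hbar : ℂ) ^ 2 / 2) / a₂ x₁, fun y => 1 + φ x₁ y, fun x hx y hy => ?_⟩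
      rw [hρx x hx x₁ hx₁ y hy]
      have := (h x₁ hx₁ y hy).1
      push_cast
      field_simp
      linear_combination -2 * this
    · push Not at ha
      -- Without a v'' term φ = -1, and the coefficient of v' is a constant times g'. Since g' is
      -- not identically zero, it determines ρ up to a constant and can serve as q.
      have hφ : ∀ y ∈ S.J, (φ x₀ y : ℂ) = -1 := fun y hy => by
        have := (h x₀ hx₀ y hy).1
        rw [ha x₀ hx₀, mul_zero, mul_eq_zero] at this
        have := this.resolve_left (by simpa using hh)
        linear_combination this
      have he : ∀ y ∈ S.J, -(Complex.I * S.hbar) * deriv S.g y = ρ x₀ y * a₁ x₀ := fun y hy => by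
        have := (h x₀ hx₀ y hy).2.2.1
        rw [hφ y hy] at this
        linear_combination this
      obtain ⟨y₁, hy₁, hg1⟩ := exists_deriv_ne_zero S.odeG hg
      have ha1 : a₁ x₀ ≠ 0 := fun h0 => by
        have := he y₁ hy₁
        rw [h0] at this
        simp [hh, hg1] at this
      refine ⟨-(Complex.I * S.hbar) / a₁ x₀, deriv S.g, fun x hx y hy => ?_⟩
      rw [hρx x hx x₀ hx₀ y hy]
      have := he y hy
      field_simp
      linear_combination -this
  have hre : ∀ (c : ℂ) (u v : ℝ) (z : ℂ), c ≠ 0 → c * u = v * ζ * z → u = v * (ζ * z / c).re := by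
    intro c u v z hc he
    have : (u : ℂ) = v * (ζ * z / c) := by field_simp; linear_combination he
    have := congrArg Complex.re this
    simpa using this
  refine ⟨fun x => (ζ * a₂ x / -((S.hbar : ℂ) ^ 2 / 2)).re, q,
    fun x => (ζ * a₁ x / -(Complex.I * S.hbar)).re, fun x => (ζ * a₀ x).re,
    fun y => B x₀ y - φ x₀ y * deriv S.f x₀, fun y => (ζ * b₀ y).re, ?_, ?_, ?_, ?_, ?_⟩
  · intro y hy h0
    apply hρ x₀ hx₀ y hy
    rw [hζ x₀ hx₀ y hy, h0]
    simp
  · intro x hx y hy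
    have := (h x hx y hy).1
    rw [hζ x hx y hy] at this
    have := hre (-((S.hbar : ℂ) ^ 2 / 2)) (1 + φ x y) (q y) (a₂ x) (by simpa using hh)
      (by push_cast; exact this)
    linarith
  · intro x hx y hy
    have := (h x hx y hy).2.2.1
    rw [hζ x hx y hy] at this
    exact hre (-(Complex.I * S.hbar)) _ (q y) (a₁ x) (by simpa using hh)
      (by push_cast; exact this)
  · intro x hx y hy
    have h1 := (h x hx y hy).2.2.2.1
    have h2 := (h x₀ hx₀ y hy).2.2.2.1
    rw [hρx x₀ hx₀ x hx y hy, ← h1] at h2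
    have := mul_left_cancel₀ (by simpa using hh) h2
    have : B x₀ y - φ x₀ y * deriv S.f x₀ = B x y - φ x y * deriv S.f x := by exact_mod_cast this
    linarith
  · intro x hx y hy
    have := (h x hx y hy).2.2.2.2
    rw [hζ x hx y hy] at this
    have h1 := congrArg Complex.re this
    have h2 : (q y * ζ * (a₀ x + b₀ y)).re = q y * ((ζ * a₀ x).re + (ζ * b₀ y).re) := by
      rw [mul_assoc, Complex.re_ofReal_mul, mul_add, Complex.add_re]
    rw [h2] at h1
    rw [← h1]
    have h3 : -(Complex.I * S.hbar / 2) * ((1 + (φ x y : ℂ)) * (dx A x y : ℝ) + (dy B x y : ℝ))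
        = ((-(S.hbar / 2) * ((1 + φ x y) * dx A x y + dy B x y) : ℝ) : ℂ) * Complex.I := by
      push_cast; ring
    rw [h3, Complex.add_re, Complex.re_ofReal_mul]
    simp

end CartesianSystem

/-! ### Consequences of separation in one variable -/

/-- The data along one of the two variables that are enforced by the separation conditions. -/
structure SideData (I : Set ℝ) (α β γ : ℝ) (f p p₁ : ℝ → ℝ) (k κ n : ℝ) : Prop where
  ode : QuadraticODE I α β γ f
  nonconst : ¬ ∃ c, ∀ x ∈ I, f x = c
  ne_zero : ∀ x ∈ I, p x ≠ 0
  hasDerivAt : ∀ x ∈ I, HasDerivAt (fun x => p x * deriv f x) (p₁ x) x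
  mul_eq : ∀ x ∈ I, p x * p₁ x = -k
  linear : ∀ x ∈ I, p x * (α * f x ^ 2 + β * f x + γ) + p₁ x = n - κ * f x

/-- `f = t₁ + (α/6) U²` with `U' = f - t₂ ≠ 0`: these are the solutions of
`f'² = (2α/3) (f - t₁) (f - t₂)²` that avoid the double root `t₂`. -/
def IsRiccati (I : Set ℝ) (f : ℝ → ℝ) (α t₁ t₂ : ℝ) : Prop :=
  ∃ U : ℝ → ℝ, ∀ x ∈ I,
    HasDerivAt U (f x - t₂) x ∧ f x = t₁ + α / 6 * U x ^ 2 ∧ f x ≠ t₂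

namespace SideData

variable {I : Set ℝ} {α β γ k κ n : ℝ} {f p p₁ : ℝ → ℝ}

theorem exists_square (h : SideData I α β γ f p p₁ k κ n) :
    ∃ c, ∀ x ∈ I, (p x * deriv f x) ^ 2 = c - 2 * k * f x := by
  obtain ⟨c, hc⟩ := exists_eq_const h.ode.isOpen h.ode.ordConnected
    (F := fun x => (p x * deriv f x) ^ 2 + 2 * k * f x) (fun x hx => by
      refine (((h.hasDerivAt x hx).fun_pow 2).add
        ((h.ode.hasDerivAt hx).const_mul (2 * k))).congr_deriv ?_
      norm_num
      linear_combination 2 * deriv f x * h.mul_eq x hx)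
  exact ⟨c, fun x hx => by linarith [hc x hx]⟩

/-- The relation `linear` times f' is a total derivative, because (p f' · f')' = f'(p₁ + p f''). -/
theorem exists_quadratic (h : SideData I α β γ f p p₁ k κ n) :
    ∃ e, ∀ x ∈ I, p x * deriv f x * deriv f x = -(κ / 2) * f x ^ 2 + n * f x + e := by
  obtain ⟨c, hc⟩ := exists_eq_const h.ode.isOpen h.ode.ordConnected
    (F := fun x => p x * deriv f x * deriv f x + κ / 2 * f x ^ 2 - n * f x) (fun x hx => by
      have h1 := h.ode.hasDerivAt hx
      refine ((((h.hasDerivAt x hx).mul (h.ode.hasDerivAt_deriv hx)).add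
        ((h1.fun_pow 2).const_mul (κ / 2))).sub (h1.const_mul n)).congr_deriv ?_
      norm_num
      linear_combination deriv f x * h.linear x hx)
  exact ⟨c, fun x hx => by linarith [hc x hx]⟩

/-- The polynomial identity `S² = (c - 2kt) P₃`, coefficient by coefficient. -/
theorem exists_coeffs (h : SideData I α β γ f p p₁ k κ n) :
    ∃ c e σ, (∀ x ∈ I, (p x * deriv f x) ^ 2 = c - 2 * k * f x) ∧
      (∀ x ∈ I, p x * deriv f x * deriv f x = -(κ / 2) * f x ^ 2 + n * f x + e) ∧
      (∀ x ∈ I, deriv f x ^ 2 = 2 / 3 * α * f x ^ 3 + β * f x ^ 2 + 2 * γ * f x + σ) ∧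
      κ ^ 2 / 4 = -(4 / 3) * k * α ∧ -κ * n = 2 / 3 * α * c - 2 * k * β ∧
      n ^ 2 - κ * e = c * β - 4 * k * γ ∧ 2 * n * e = 2 * c * γ - 2 * k * σ ∧ e ^ 2 = c * σ := by
  obtain ⟨c, hc⟩ := h.exists_square
  obtain ⟨e, he⟩ := h.exists_quadratic
  obtain ⟨σ, hσ⟩ := h.ode.exists_first_integral
  -- With S(t) = -(κ/2)t² + nt + e, squaring p f' · f' in two ways gives S(f)² = (c - 2kf) P₃(f),
  -- and a nonconstant f satisfies this only if all coefficients agree.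
  obtain ⟨e4, e3, e2, e1, e0⟩ := coeffs_eq_zero h.ode.ordConnected h.ode.continuousOn h.nonconst
    (a₄ := κ ^ 2 / 4 + 4 / 3 * k * α) (a₃ := -κ * n - (2 / 3 * α * c - 2 * k * β))
    (a₂ := n ^ 2 - κ * e - (c * β - 4 * k * γ)) (a₁ := 2 * n * e - (2 * c * γ - 2 * k * σ))
    (a₀ := e ^ 2 - c * σ) (fun x hx => by
      have h1 := hc x hx
      have h2 := he x hx
      have h3 := hσ x hx
      have h4 : (p x * deriv f x * deriv f x) ^ 2 = (c - 2 * k * f x) * deriv f x ^ 2 := by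
        rw [← h1]; ring
      rw [h2, h3] at h4
      linear_combination h4)
  exact ⟨c, e, σ, hc, he, hσ, by linarith, by linarith, by linarith, by linarith, by linarith⟩

theorem not_forall_mul_eq_zero (h : SideData I α β γ f p p₁ k κ n) :
    ¬ ∀ x ∈ I, (p x * deriv f x) ^ 2 = 0 := by
  intro h0
  obtain ⟨x, hx, -, -, h1, -⟩ := h.ode.exists_ne h.nonconst
  have := h0 x hx
  simp [h.ne_zero x hx, h1] at this

/-- In S² = (c - 2kt) P₃ the linear factor is nontrivial and its root t₁ is a root of S. With t₂ the
other root of S, P₃ is a multiple of (t - t₁)(t - t₂)², and p₁ becomes a multiple of f - t₂. Then p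
p₁ = -k ≠ 0 shows that f avoids t₂ and determines p. -/
theorem of_ne_zero (h : SideData I α β γ f p p₁ k κ n) (hα : α ≠ 0) :
    k ≠ 0 ∧ κ ≠ 0 ∧ ∃ t₁ t₂, IsRiccati I f α t₁ t₂ ∧
      ∀ x ∈ I, p x = 4 * k / (κ * (f x - t₂)) := by
  obtain ⟨c, e, σ, hc, he, hσ, e4, e3, e2, e1, e0⟩ := h.exists_coeffs
  have hk : k ≠ 0 := by
    rintro rfl
    have hκ : κ = 0 := by simpa using e4
    have hc0 : c = 0 := by simpa [hκ, hα] using e3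
    exact h.not_forall_mul_eq_zero fun x hx => by rw [hc x hx, hc0]; ring
  have hκ : κ ≠ 0 := by
    rintro rfl
    have : k * α = 0 := by linarith
    simp [hk, hα] at this
  obtain ⟨t₁, ht₁⟩ : ∃ t₁, c = 2 * k * t₁ := ⟨c / (2 * k), by field_simp⟩
  -- By Vieta, t₂ is the second root of S once t₁ is known to be one; that follows from S(t₁)² = 0.
  obtain ⟨t₂, ht₂⟩ : ∃ t₂, n = κ / 2 * (t₁ + t₂) := ⟨2 * n / κ - t₁, by field_simp; ring⟩
  have hroot : -(κ / 2) * t₁ ^ 2 + n * t₁ + e = 0 := by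
    have : (-(κ / 2) * t₁ ^ 2 + n * t₁ + e) ^ 2 = 0 := by
      rw [ht₁] at e0 e1 e2 e3
      linear_combination t₁ ^ 4 * e4 + t₁ ^ 3 * e3 + t₁ ^ 2 * e2 + t₁ * e1 + e0
    exact pow_eq_zero_iff (by norm_num) |>.1 this
  have he' : e = -(κ / 2) * t₁ * t₂ := by rw [ht₂] at hroot; linear_combination hroot
  have hf2 : β = -(2 * α / 3) * (t₁ + 2 * t₂) ∧ γ = α / 3 * t₂ ^ 2 + 2 * α / 3 * (t₁ * t₂) := by
    rw [ht₁, ht₂] at e3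
    rw [ht₁, ht₂, he'] at e2
    have hβ : β = -(2 * α / 3) * (t₁ + 2 * t₂) := by
      apply mul_left_cancel₀ (mul_ne_zero two_ne_zero hk)
      linear_combination e3 + (2 * (t₁ + t₂)) * e4
    refine ⟨hβ, ?_⟩
    rw [hβ] at e2
    apply mul_left_cancel₀ (mul_ne_zero four_ne_zero hk)
    linear_combination e2 - ((t₁ + t₂) ^ 2 + 2 * t₁ * t₂) * e4
  have hp1 : ∀ x ∈ I, p₁ x = -(κ / 4) * (f x - t₂) := by
    intro x hx
    have h1 := hc x hx
    have h2 := he x hx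
    have h3 := h.mul_eq x hx
    have h4 := h.linear x hx
    rw [ht₁] at h1
    rw [he', ht₂] at h2
    rw [ht₂, hf2.1, hf2.2] at h4
    -- Where f = t₁ the factor p f' vanishes and cannot be divided out. There, eliminating p between
    -- `linear` and `mul_eq` gives a quadratic equation for p₁, which is a perfect square by the
    -- leading coefficient relation `e4`.
    by_cases hft : f x = t₁
    · have h5 : (p₁ x + κ / 4 * (t₁ - t₂)) ^ 2 = 0 := by
        rw [hft] at h4
        linear_combination p₁ x * h4 - α / 3 * (t₁ - t₂) ^ 2 * h3 + (t₁ - t₂) ^ 2 / 4 * e4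
      have h6 := pow_eq_zero_iff (two_ne_zero) |>.1 h5
      rw [hft]
      linear_combination h6
    · have h5 : p₁ x * (2 * k * (f x - t₁)) = -(κ / 4) * (f x - t₂) * (2 * k * (f x - t₁)) := by
        linear_combination p₁ x * h1 - p x * deriv f x * deriv f x * h3 + k * h2
      exact mul_right_cancel₀
        (mul_ne_zero (mul_ne_zero two_ne_zero hk) (sub_ne_zero.2 hft)) h5
  have hne : ∀ x ∈ I, f x - t₂ ≠ 0 := by
    intro x hx h0
    have h3 := h.mul_eq x hx
    rw [hp1 x hx, h0] at h3
    apply hk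
    linarith
  -- The factor -4/κ turns (p f')' = p₁ = -(κ/4)(f - t₂) into U' = f - t₂.
  refine ⟨hk, hκ, t₁, t₂, ⟨fun x => -(4 / κ) * (p x * deriv f x), fun x hx => ⟨?_, ?_, ?_⟩⟩, ?_⟩
  · refine ((h.hasDerivAt x hx).const_mul (-(4 / κ))).congr_deriv ?_
    rw [hp1 x hx]
    field_simp
  · rw [mul_pow, hc x hx, ht₁]
    field_simp
    linear_combination 24 * (f x - t₁) * e4
  · exact sub_ne_zero.1 (hne x hx)
  · intro x hx
    have h3 := h.mul_eq x hx
    have h4 := hne x hx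
    rw [hp1 x hx] at h3
    field_simp
    linear_combination -4 * h3

/-- The leading coefficient gives κ = 0. If k = 0, then p f' is a nonzero constant d and the
relation d f' = n f + e is affine. If k ≠ 0, the cubic coefficient gives β = 0 and the quadratic one
n² = -4kγ. -/
theorem of_eq_zero (h : SideData I α β γ f p p₁ k κ n) (hα : α = 0) :
    (k = 0 → ∃ κ' e', ∀ x ∈ I, deriv f x = κ' * f x + e') ∧ (k ≠ 0 → β = 0 ∧ k * γ < 0) := by
  obtain ⟨c, e, σ, hc, he, hσ, e4, e3, e2, e1, e0⟩ := h.exists_coeffs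
  subst hα
  have hκ : κ = 0 := by simpa using e4
  subst hκ
  constructor
  · rintro rfl
    have hc0 : c ≠ 0 := fun hc0 => h.not_forall_mul_eq_zero fun x hx => by
      rw [hc x hx, hc0]; ring
    obtain ⟨d, hd⟩ := exists_eq_const h.ode.isOpen h.ode.ordConnected
      (F := fun x => p x * deriv f x) (fun x hx => by
        refine (h.hasDerivAt x hx).congr_deriv ?_
        simpa [h.ne_zero x hx] using h.mul_eq x hx)
    rcases I.eq_empty_or_nonempty with rfl | ⟨x₀, hx₀⟩
    · exact ⟨0, 0, by simp⟩
    have hd0 : d ≠ 0 := by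
      rintro rfl
      exact hc0 (by have := hc x₀ hx₀; rw [hd x₀ hx₀] at this; linarith)
    refine ⟨n / d, e / d, fun x hx => ?_⟩
    have := he x hx
    rw [hd x hx] at this
    field_simp
    linarith
  · intro hk
    have hβ : β = 0 := by
      have : k * β = 0 := by linarith
      exact (mul_eq_zero.1 this).resolve_left hk
    subst hβ
    refine ⟨rfl, ?_⟩
    -- With γ = 0 the relations give n = 0 and σ = 0, hence f' = 0, so f would be constant.
    have hkγ : k * γ ≠ 0 := by
      intro h0
      have hγ : γ = 0 := (mul_eq_zero.1 h0).resolve_left hk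
      subst hγ
      have hn : n = 0 := by nlinarith
      subst hn
      have hσ0 : σ = 0 := by
        have : k * σ = 0 := by linarith
        exact (mul_eq_zero.1 this).resolve_left hk
      obtain ⟨x, hx, -, -, h1, -⟩ := h.ode.exists_ne h.nonconst
      have := hσ x hx
      rw [hσ0] at this
      apply h1
      simpa using this
    exact lt_of_le_of_ne (by nlinarith [sq_nonneg n]) hkγ

end SideData

/-- Differentiating g' = κg + e and comparing with the second order equation gives a = 0, δ = κ², ξ
= κe. So κ = 0 leaves affine functions, and κ ≠ 0 leaves one exponential, with exponent κ = ±√δ. -/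
theorem exists_solution_of_linear {J : Set ℝ} {a δ ξ κ e : ℝ} {g : ℝ → ℝ}
    (h : QuadraticODE J a δ ξ g) (hn : ¬ ∃ c, ∀ y ∈ J, g y = c)
    (hl : ∀ y ∈ J, deriv g y = κ * g y + e) :
    (a = 0 ∧ δ = 0 ∧ ξ = 0 ∧ ∃ g₀ g₁ : ℝ, ∀ y ∈ J, g y = g₀ * y + g₁) ∨
    (a = 0 ∧ 0 < δ ∧ ∃ g₁ g₂ : ℝ, g₁ * g₂ = 0 ∧
      ∀ y ∈ J, g y = g₁ * Real.exp (√δ * y) + g₂ * Real.exp (-√δ * y) - ξ / δ) := by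
  have h2 : ∀ y ∈ J, a * g y ^ 2 + δ * g y + ξ = κ * (κ * g y + e) := fun y hy => by
    have h3 : HasDerivAt (deriv g) (κ * deriv g y) y :=
      ((h.hasDerivAt hy).const_mul κ |>.add_const e).congr_of_eventuallyEq
        (by filter_upwards [h.isOpen.mem_nhds hy] with z hz using hl z hz)
    rw [← hl y hy]
    exact (h.hasDerivAt_deriv hy).unique h3
  obtain ⟨-, -, ha, hδ, hξ⟩ := coeffs_eq_zero h.ordConnected h.continuousOn hn (a₄ := 0) (a₃ := 0)
    (a₂ := a) (a₁ := δ - κ ^ 2) (a₀ := ξ - κ * e)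
    (fun y hy => by linear_combination h2 y hy)
  by_cases hκ : κ = 0
  · left
    subst hκ
    refine ⟨ha, by linarith, by linarith, e, ?_⟩
    obtain ⟨c, hc⟩ := exists_eq_const h.isOpen h.ordConnected (F := fun y => g y - e * y)
      (fun y hy => by
        refine ((h.hasDerivAt hy).sub ((hasDerivAt_id y).const_mul e)).congr_deriv ?_
        rw [hl y hy]
        ring)
    exact ⟨c, fun y hy => by linarith [hc y hy]⟩
  · right
    have hδ' : δ = κ ^ 2 := by linarith
    have hδ0 : 0 < δ := by rw [hδ']; positivity
    refine ⟨ha, hδ0, ?_⟩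
    obtain ⟨c, hc⟩ := exists_eq_const h.isOpen h.ordConnected
      (F := fun y => (g y + ξ / δ) * Real.exp (-(κ * y)))
      (fun y hy => by
        have h4 : HasDerivAt (fun y => Real.exp (-(κ * y))) (Real.exp (-(κ * y)) * -(κ * 1)) y :=
          ((hasDerivAt_id y).const_mul κ).neg.exp
        refine (((h.hasDerivAt hy).add_const (ξ / δ)).mul h4).congr_deriv ?_
        have : ξ / δ = e / κ := by
          rw [hδ', show ξ = κ * e by linarith]; field_simp
        rw [hl y hy, this]
        field_simp
        ring)
    have hg : ∀ y ∈ J, g y = c * Real.exp (κ * y) - ξ / δ := fun y hy => by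
      have h5 := hc y hy
      have h6 : Real.exp (-(κ * y)) * Real.exp (κ * y) = 1 := by
        rw [← Real.exp_add]; simp
      linear_combination Real.exp (κ * y) * h5 - (g y + ξ / δ) * h6
    rcases lt_or_gt_of_ne hκ with hk | hk
    · have hs : √δ = -κ := by
        rw [hδ', ← neg_sq, Real.sqrt_sq (by linarith)]
      exact ⟨0, c, by simp, fun y hy => by rw [hs, hg y hy]; simp⟩
    · have hs : √δ = κ := by rw [hδ', Real.sqrt_sq hk.le]
      exact ⟨c, 0, by simp, fun y hy => by rw [hs, hg y hy]; simp⟩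

/-! ### From the real form to the data in each variable -/

namespace CartesianSystem

namespace RealForm

variable {S : CartesianSystem} {E lam : ℝ} {φ A B : ℝ → ℝ → ℝ} {p q a r η t : ℝ → ℝ}

/-- Nothing is known about the regularity of p, but p f' = (B + f' - η)/q inherits differentiability
in x from B and f'. -/
theorem hasDerivAt_p (h : S.RealForm E lam φ A B p q a r η t) (hv : S.IsVectorPotential A B)
    {x y : ℝ} (hx : x ∈ S.I) (hy : y ∈ S.J) :
    HasDerivAt (fun x => p x * deriv S.f x) ((dx B x y + deriv (deriv S.f) x) / q y) x := by
  have h1 : HasDerivAt (fun s => (B s y + deriv S.f s - η y) / q y)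
      ((dx B x y + deriv (deriv S.f) x) / q y) x :=
    (((hv.differentiableAt hx hy).2.2.1.hasDerivAt.add
      (S.odeF.hasDerivAt_deriv hx).differentiableAt.hasDerivAt).sub_const _).div_const _
  refine h1.congr_of_eventuallyEq ?_
  filter_upwards [S.I_open.mem_nhds hx] with s hs
  have h2 := h.eq_B s hs y hy
  have h3 := h.eq_phi s hs y hy
  have h4 := h.ne_zero y hy
  rw [h2, h3]
  field_simp
  ring

/-- The equation `A_y - B_x = Ω` splits: `p (p f')' = -k` and `(g'/q)' = k q`. -/
theorem exists_splitting (h : S.RealForm E lam φ A B p q a r η t)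
    (hv : S.IsVectorPotential A B) :
    ∃ (k : ℝ) (p₁ : ℝ → ℝ),
      (∀ x ∈ S.I, HasDerivAt (fun x => p x * deriv S.f x) (p₁ x) x ∧ p x * p₁ x = -k) ∧
      (∀ x ∈ S.I, ∀ y ∈ S.J, dx B x y + deriv (deriv S.f) x = q y * p₁ x) ∧
      ∀ y ∈ S.J, HasDerivAt (fun y => deriv S.g y / q y) (k * q y) y := by
  obtain ⟨x₀, hx₀⟩ := S.I_nonempty
  obtain ⟨y₀, hy₀⟩ := S.J_nonempty
  set p₁ : ℝ → ℝ := fun x => (dx B x y₀ + deriv (deriv S.f) x) / q y₀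
  have hp : ∀ x ∈ S.I, HasDerivAt (fun x => p x * deriv S.f x) (p₁ x) x := fun x hx =>
    h.hasDerivAt_p hv hx hy₀
  have hB : ∀ x ∈ S.I, ∀ y ∈ S.J, dx B x y + deriv (deriv S.f) x = q y * p₁ x := by
    intro x hx y hy
    have h1 := (hp x hx).unique (h.hasDerivAt_p hv hx hy)
    have := h.ne_zero y hy
    rw [h1]
    field_simp
  have hQ : ∀ x ∈ S.I, ∀ y ∈ S.J,
      HasDerivAt (fun y => deriv S.g y / q y) (-(p x * p₁ x) * q y) y := by
    intro x hx y hy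
    -- For fixed x this function equals g'/q by `eq_A`, so g'/q is differentiable although q need
    -- not be. The field equation evaluates its derivative.
    have h1 : HasDerivAt (fun s => a x + p x * deriv S.g s - p x * A x s)
        (p x * deriv (deriv S.g) y - p x * dy A x y) y :=
      (((S.odeG.hasDerivAt_deriv hy).differentiableAt.hasDerivAt.const_mul (p x)).const_add
        (a x)).sub ((hv.differentiableAt hx hy).2.1.hasDerivAt.const_mul (p x))
    have h2 : p x * deriv (deriv S.g) y - p x * dy A x y = -(p x * p₁ x) * q y := by
      have h3 := hv.2.2 x hx y hy
      simp only [Ω] at h3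
      linear_combination -p x * h3 - p x * hB x hx y hy
    rw [← h2]
    refine h1.congr_of_eventuallyEq ?_
    filter_upwards [S.J_open.mem_nhds hy] with s hs
    have h4 := h.eq_A x hx s hs
    rw [h.eq_phi x hx s hs] at h4
    have := h.ne_zero s hs
    field_simp
    linear_combination h4
  refine ⟨-(p x₀ * p₁ x₀), p₁, fun x hx => ⟨hp x hx, ?_⟩, hB, hQ x₀ hx₀⟩
  -- The function g'/q does not involve x, so neither can p p₁.
  have h1 := (hQ x hx y₀ hy₀).unique (hQ x₀ hx₀ y₀ hy₀)
  have h2 := mul_right_cancel₀ (h.ne_zero y₀ hy₀) h1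
  linarith

/-- If `p f' = 0`, then `φ = -1` off the zeros of `f'`, and `g'` is an affine function of `g`. -/
theorem exists_linear (h : S.RealForm E lam φ A B p q a r η t) (hv : S.IsVectorPotential A B)
    (hf : ¬ ∃ c, ∀ x ∈ S.I, S.f x = c) (hg : ¬ ∃ c, ∀ y ∈ S.J, S.g y = c)
    (h0 : ∀ x ∈ S.I, p x * deriv S.f x = 0) :
    ∃ κ e, ∀ y ∈ S.J, deriv S.g y = κ * S.g y + e := by
  obtain ⟨k, p₁, hp, hB, hQ⟩ := h.exists_splitting hv
  have hp1 : ∀ x ∈ S.I, p₁ x = 0 := fun x hx => by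
    refine (hp x hx).1.unique ((hasDerivAt_const x (0 : ℝ)).congr_of_eventuallyEq ?_)
    filter_upwards [S.I_open.mem_nhds hx] with s hs using h0 s hs
  -- Since (p f')' = 0, the splitting gives B_x = -f'', and the field equation reduces to A_y = g''.
  have hA : ∀ x ∈ S.I, ∃ τ, ∀ y ∈ S.J, A x y - deriv S.g y = τ := fun x hx =>
    exists_eq_const S.J_open S.J_interval fun y hy => by
      refine ((hv.differentiableAt hx hy).2.1.hasDerivAt.sub
        (S.odeG.hasDerivAt_deriv hy).differentiableAt.hasDerivAt).congr_deriv ?_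
      have h1 := hv.2.2 x hx y hy
      have h2 := hB x hx y hy
      rw [hp1 x hx] at h2
      simp only [Ω, dy] at h1
      linear_combination h1 + h2
  obtain ⟨σ₁, hσ₁⟩ := S.odeF.exists_first_integral
  obtain ⟨x₁, hx₁, x₂, hx₂, hf1, hf2, hne⟩ := S.odeF.exists_ne hf
  obtain ⟨y₁, hy₁, hg1⟩ := exists_deriv_ne_zero S.odeG hg
  have key : ∀ x ∈ S.I, deriv S.f x ≠ 0 → ∃ τ, ∀ y ∈ S.J, deriv S.g y = q y * a x ∧
      S.f x * deriv (deriv S.g) y + deriv S.g y * τ + S.potentialY σ₁ E lam (η y) y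
        = q y * (r x + t y) := by
    intro x hx hfx
    obtain ⟨τ, hτ⟩ := hA x hx
    have hpx : p x = 0 := (mul_eq_zero.1 (h0 x hx)).resolve_right hfx
    refine ⟨τ, fun y hy => ?_⟩
    have hφ : φ x y = -1 := by rw [h.eq_phi x hx y hy, hpx]; ring
    constructor
    · have := h.eq_A x hx y hy
      rw [hφ] at this
      linear_combination this
    · rw [← h.eq_zeroth x hx y hy, hφ, S.zerothOrder_neg_one (hσ₁ x hx) (τ := τ) (η := η y)
        (by linarith [hτ y hy]) (by rw [h.eq_B x hx y hy, hφ]; ring), S.g_ode y hy]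
  obtain ⟨τ₁, h1⟩ := key x₁ hx₁ hf1
  obtain ⟨τ₂, h2⟩ := key x₂ hx₂ hf2
  have ha : a x₁ ≠ 0 := fun ha => hg1 (by rw [(h1 y₁ hy₁).1, ha, mul_zero])
  have hd : S.f x₁ - S.f x₂ ≠ 0 := sub_ne_zero.2 hne
  -- Subtracting the zeroth order conditions at x₁ and x₂ removes all terms in y alone. With q =
  -- g'/a(x₁) the remainder reads g'' = κ g'.
  set κ := ((r x₁ - r x₂) / a x₁ - (τ₁ - τ₂)) / (S.f x₁ - S.f x₂) with hκ
  have hgg : ∀ y ∈ S.J, deriv (deriv S.g) y = κ * deriv S.g y := by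
    intro y hy
    obtain ⟨h3, h4⟩ := h1 y hy
    have h5 := (h2 y hy).2
    rw [hκ]
    field_simp
    linear_combination a x₁ * (h4 - h5) - (r x₁ - r x₂) * h3
  obtain ⟨e, he⟩ := exists_eq_const S.J_open S.J_interval
    (F := fun y => deriv S.g y - κ * S.g y) (fun y hy => by
      refine ((S.odeG.hasDerivAt_deriv hy).differentiableAt.hasDerivAt.sub
        ((S.odeG.hasDerivAt hy).const_mul κ)).congr_deriv ?_
      rw [hgg y hy]
      ring)
  exact ⟨κ, e, fun y hy => by linarith [he y hy]⟩

/-- Either `p` has no zeros, or `p f'` vanishes identically. -/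
theorem ne_zero_or (h : S.RealForm E lam φ A B p q a r η t) (hv : S.IsVectorPotential A B) :
    (∀ x ∈ S.I, p x ≠ 0) ∨ ∀ x ∈ S.I, p x * deriv S.f x = 0 := by
  obtain ⟨k, p₁, hp, -, -⟩ := h.exists_splitting hv
  by_cases hk : k = 0
  · subst hk
    -- For k = 0 the square of p f' is constant, so p f' vanishes either everywhere or nowhere.
    obtain ⟨c, hc⟩ := exists_eq_const S.I_open S.I_interval
      (F := fun x => (p x * deriv S.f x) ^ 2) (fun x hx => by
        refine ((hp x hx).1.fun_pow 2).congr_deriv ?_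
        push_cast
        linear_combination 2 * deriv S.f x * (hp x hx).2)
    by_cases hc0 : c = 0
    · right
      intro x hx
      have := hc x hx
      rw [hc0] at this
      exact pow_eq_zero_iff two_ne_zero |>.1 this
    · left
      intro x hx h0
      apply hc0
      rw [← hc x hx, h0]
      ring
  · left
    intro x hx h0
    have := (hp x hx).2
    rw [h0] at this
    apply hk
    linarith

/-- The zeroth order condition becomes f u(y) + g w(x) = X(x) + Y(y). Its mixed second differences
vanish, so (f - f')(u - u') + (g - g')(w - w') = 0, with primes for values at second points. Fixing
points where f and g differ makes u affine in g and w affine in f, with opposite slopes. -/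
theorem exists_sideData (h : S.RealForm E lam φ A B p q a r η t) (hv : S.IsVectorPotential A B)
    (hf : ¬ ∃ c, ∀ x ∈ S.I, S.f x = c) (hg : ¬ ∃ c, ∀ y ∈ S.J, S.g y = c)
    (hp0 : ∀ x ∈ S.I, p x ≠ 0) :
    ∃ (k κ n l : ℝ) (p₁ q₁ : ℝ → ℝ), SideData S.I S.α S.β S.γ S.f p p₁ k κ n ∧
      SideData S.J (-S.α) S.δ S.ξ S.g (fun y => 1 / q y) q₁ (-k) (-κ) l := by
  obtain ⟨k, p₁, hp, hB, hQ⟩ := h.exists_splitting hv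
  obtain ⟨c₁, hc₁⟩ := exists_eq_const S.I_open S.I_interval
    (F := fun x => (p x * deriv S.f x) ^ 2 + 2 * k * S.f x) (fun x hx => by
      refine (((hp x hx).1.fun_pow 2).add
        ((S.odeF.hasDerivAt hx).const_mul (2 * k))).congr_deriv ?_
      norm_num
      linear_combination 2 * deriv S.f x * (hp x hx).2)
  obtain ⟨c₂, hc₂⟩ := exists_eq_const S.J_open S.J_interval
    (F := fun y => (deriv S.g y / q y) ^ 2 - 2 * k * S.g y) (fun y hy => by
      refine (((hQ y hy).fun_pow 2).sub
        ((S.odeG.hasDerivAt hy).const_mul (2 * k))).congr_deriv ?_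
      have := h.ne_zero y hy
      norm_num
      field_simp
      ring)
  obtain ⟨σ₁, hσ₁⟩ := S.odeF.exists_first_integral
  obtain ⟨σ₂, hσ₂⟩ := S.odeG.exists_first_integral
  set u : ℝ → ℝ := fun y => (-S.α * S.g y ^ 2 + S.δ * S.g y + S.ξ) / q y + k * q y with hu
  set w : ℝ → ℝ := fun x => p x * (S.α * S.f x ^ 2 + S.β * S.f x + S.γ) - k / p x with hw
  set X : ℝ → ℝ := fun x => r x - S.restX c₂ σ₂ lam (p x) (a x / p x) x with hX
  set Y : ℝ → ℝ := fun y => t y - (S.potentialY σ₁ E lam (η y) y / q y - c₁ * q y / 2) with hY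
  have key : ∀ x ∈ S.I, ∀ y ∈ S.J, S.f x * u y + S.g y * w x = X x + Y y := by
    intro x hx y hy
    have h1 := hp0 x hx
    have h2 := h.ne_zero y hy
    have h3 := h.eq_phi x hx y hy
    have h4 := h.eq_A x hx y hy
    have h5 := h.eq_B x hx y hy
    have h6 := h.eq_zeroth x hx y hy
    rw [h3] at h4 h5 h6
    rw [S.zerothOrder_eq h1 h2 (hσ₁ x hx) (hσ₂ y hy) (c₁ := c₁) (c₂ := c₂) (k := k)
      (τ := a x / p x) (η := η y)
      (by linarith [hc₁ x hx]) (by linarith [hc₂ y hy])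
      (by field_simp; linear_combination h4) h5] at h6
    have h7 := mul_left_cancel₀ h2 h6
    simp only [hu, hw, hX, hY]
    linear_combination h7
  obtain ⟨x₁, hx₁, x₂, hx₂, -, -, hf12⟩ := S.odeF.exists_ne hf
  obtain ⟨y₁, hy₁, y₂, hy₂, -, -, hg12⟩ := S.odeG.exists_ne hg
  have hf0 : S.f x₁ - S.f x₂ ≠ 0 := sub_ne_zero.2 hf12
  have hg0 : S.g y₁ - S.g y₂ ≠ 0 := sub_ne_zero.2 hg12
  have hmix : ∀ x ∈ S.I, ∀ x' ∈ S.I, ∀ y ∈ S.J, ∀ y' ∈ S.J,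
      (S.f x - S.f x') * (u y - u y') + (S.g y - S.g y') * (w x - w x') = 0 := by
    intro x hx x' hx' y hy y' hy'
    linear_combination key x hx y hy - key x' hx' y hy - key x hx y' hy' + key x' hx' y' hy'
  set κ := (u y₁ - u y₂) / (S.g y₁ - S.g y₂) with hκ
  have hκ' : u y₁ - u y₂ = κ * (S.g y₁ - S.g y₂) := by rw [hκ]; field_simp
  have hwx : ∀ x ∈ S.I, ∀ x' ∈ S.I, w x - w x' = -κ * (S.f x - S.f x') := by
    intro x hx x' hx'
    apply mul_left_cancel₀ hg0
    linear_combination hmix x hx x' hx' y₁ hy₁ y₂ hy₂ - (S.f x - S.f x') * hκ'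
  have huy : ∀ y ∈ S.J, ∀ y' ∈ S.J, u y - u y' = κ * (S.g y - S.g y') := by
    intro y hy y' hy'
    apply mul_left_cancel₀ hf0
    linear_combination hmix x₁ hx₁ x₂ hx₂ y hy y' hy'
      - (S.g y - S.g y') * hwx x₁ hx₁ x₂ hx₂
  refine ⟨k, κ, w x₁ + κ * S.f x₁, u y₁ - κ * S.g y₁, p₁, fun y => k * q y,
    ⟨S.odeF, hf, hp0, fun x hx => (hp x hx).1, fun x hx => (hp x hx).2, fun x hx => ?_⟩,
    ⟨S.odeG, hg, fun y hy => one_div_ne_zero (h.ne_zero y hy), fun y hy => ?_, fun y hy => ?_,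
      fun y hy => ?_⟩⟩
  · have h1 := hwx x hx x₁ hx₁
    have h2 := hp0 x hx
    have h3 : p₁ x = -(k / p x) := by
      have := (hp x hx).2
      field_simp
      linear_combination this
    rw [h3]
    simp only [hw] at h1 ⊢
    linear_combination h1
  · refine (hQ y hy).congr_of_eventuallyEq (Filter.Eventually.of_forall fun s => ?_)
    simp only
    ring
  · have := h.ne_zero y hy
    field_simp
  · have h1 := huy y hy y₁ hy₁
    simp only [hu] at h1 ⊢
    linear_combination h1

end RealForm

end CartesianSystem

/-! ### Construction of separating triples -/

section Product

variable {I J : Set ℝ} {u : ℝ → ℝ}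

theorem ContDiffOn.comp_fst_prod (hu : ContDiffOn ℝ ∞ u I) :
    ContDiffOn ℝ ∞ (fun z : ℝ × ℝ => u z.1) (I ×ˢ J) :=
  hu.comp contDiffOn_fst fun _ hz => hz.1

theorem ContDiffOn.comp_snd_prod (hu : ContDiffOn ℝ ∞ u J) :
    ContDiffOn ℝ ∞ (fun z : ℝ × ℝ => u z.2) (I ×ˢ J) :=
  hu.comp contDiffOn_snd fun _ hz => hz.2

theorem ContDiffOn.hasDerivAt_of_isOpen (hI : IsOpen I) (hu : ContDiffOn ℝ ∞ u I) {x : ℝ}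
    (hx : x ∈ I) : HasDerivAt u (deriv u x) x :=
  ((hu.contDiffAt (hI.mem_nhds hx)).differentiableAt (by simp)).hasDerivAt

end Product

namespace CartesianSystem

variable {S : CartesianSystem}

/-- The necessary conditions read backwards, with ρ = q. `hre` separates the real part of the zeroth
order term. `him` removes the mixed part of (1 + φ)A_x + B_y, that is, of the imaginary part, which
the necessity argument never used. -/
theorem separates_of_factors {E lam k c₁ c₂ : ℝ} {φ A B : ℝ → ℝ → ℝ}
    {p q p₁ τ η X Y : ℝ → ℝ}
    (hp : ContDiffOn ℝ ∞ p S.I) (hq : ContDiffOn ℝ ∞ q S.J)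
    (hτ : ContDiffOn ℝ ∞ τ S.I) (hη : ContDiffOn ℝ ∞ η S.J)
    (hp0 : ∀ x ∈ S.I, p x ≠ 0) (hq0 : ∀ y ∈ S.J, q y ≠ 0)
    (hP : ∀ x ∈ S.I, HasDerivAt (fun x => p x * deriv S.f x) (p₁ x) x)
    (hk : ∀ x ∈ S.I, p x * p₁ x = -k)
    (hQ : ∀ y ∈ S.J, HasDerivAt (fun y => deriv S.g y / q y) (k * q y) y)
    (hP2 : ∀ x ∈ S.I, (p x * deriv S.f x) ^ 2 = c₁ - 2 * k * S.f x)
    (hQ2 : ∀ y ∈ S.J, (deriv S.g y / q y) ^ 2 = c₂ + 2 * k * S.g y)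
    (hre : ∀ x ∈ S.I, ∀ y ∈ S.J,
      S.f x * ((-S.α * S.g y ^ 2 + S.δ * S.g y + S.ξ) / q y + k * q y)
        + S.g y * (p x * (S.α * S.f x ^ 2 + S.β * S.f x + S.γ) - k / p x) = X x + Y y)
    (him : ∀ x ∈ S.I, ∀ y ∈ S.J,
      deriv p x / p x * (deriv S.g y / q y) + deriv q y / q y * (p x * deriv S.f x) = 0)
    (hφ : ∀ x ∈ S.I, ∀ y ∈ S.J, φ x y = p x * q y - 1)
    (hA : ∀ x ∈ S.I, ∀ y ∈ S.J, A x y = τ x + φ x y / (1 + φ x y) * deriv S.g y)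
    (hB : ∀ x ∈ S.I, ∀ y ∈ S.J, B x y = η y + φ x y * deriv S.f x) :
    S.IsVectorPotential A B ∧ S.Separates E lam φ A B := by
  have hA' : ∀ x ∈ S.I, ∀ y ∈ S.J,
      A x y = τ x + deriv S.g y - deriv S.g y / q y / p x := by
    intro x hx y hy
    have h1 := hp0 x hx
    have h2 := hq0 y hy
    rw [hA x hx y hy, hφ x hx y hy]
    have : 1 + (p x * q y - 1) = p x * q y := by ring
    rw [this]
    field_simp
    ring
  have hB' : ∀ x ∈ S.I, ∀ y ∈ S.J,
      B x y = η y + (p x * deriv S.f x * q y - deriv S.f x) := by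
    intro x hx y hy
    rw [hB x hx y hy, hφ x hx y hy]
    ring
  have dyA : ∀ x ∈ S.I, ∀ y ∈ S.J, dy A x y = deriv (deriv S.g) y - k * q y / p x := by
    intro x hx y hy
    have h1 : HasDerivAt (fun s => τ x + deriv S.g s - deriv S.g s / q s / p x)
        (deriv (deriv S.g) y - k * q y / p x) y :=
      ((S.odeG.hasDerivAt_deriv hy).differentiableAt.hasDerivAt.const_add (τ x)).sub
        ((hQ y hy).div_const (p x))
    refine (h1.congr_of_eventuallyEq ?_).deriv
    filter_upwards [S.J_open.mem_nhds hy] with s hs using hA' x hx s hs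
  have dxB : ∀ x ∈ S.I, ∀ y ∈ S.J, dx B x y = p₁ x * q y - deriv (deriv S.f) x := by
    intro x hx y hy
    have h1 : HasDerivAt (fun s => η y + (p s * deriv S.f s * q y - deriv S.f s))
        (p₁ x * q y - deriv (deriv S.f) x) x :=
      (((hP x hx).mul_const (q y)).sub
        (S.odeF.hasDerivAt_deriv hx).differentiableAt.hasDerivAt).const_add (η y)
    refine (h1.congr_of_eventuallyEq ?_).deriv
    filter_upwards [S.I_open.mem_nhds hx] with s hs using hB' s hs y hy
  have dxA : ∀ x ∈ S.I, ∀ y ∈ S.J,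
      dx A x y = deriv τ x + deriv S.g y / q y * (deriv p x / p x ^ 2) := by
    intro x hx y hy
    have h1 := ((hτ.hasDerivAt_of_isOpen S.I_open hx).add_const (deriv S.g y)).fun_sub
      ((hasDerivAt_const x (deriv S.g y / q y)).fun_div (hp.hasDerivAt_of_isOpen S.I_open hx)
        (hp0 x hx))
    refine ((h1.congr_of_eventuallyEq ?_).congr_deriv ?_).deriv
    · filter_upwards [S.I_open.mem_nhds hx] with s hs using hA' s hs y hy
    · ring
  have dyB : ∀ x ∈ S.I, ∀ y ∈ S.J, dy B x y = deriv η y + p x * deriv S.f x * deriv q y := by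
    intro x hx y hy
    have h1 := (hη.hasDerivAt_of_isOpen S.J_open hy).fun_add
      (((hq.hasDerivAt_of_isOpen S.J_open hy).const_mul (p x * deriv S.f x)).sub_const
        (deriv S.f x))
    refine (h1.congr_of_eventuallyEq ?_).deriv
    filter_upwards [S.J_open.mem_nhds hy] with s hs using hB' x hx s hs
  have hv : S.IsVectorPotential A B := by
    refine ⟨?_, ?_, ?_⟩
    · refine ContDiffOn.congr (f := fun z : ℝ × ℝ =>
        τ z.1 + deriv S.g z.2 - deriv S.g z.2 / q z.2 / p z.1) ?_ fun z hz =>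
          hA' z.1 hz.1 z.2 hz.2
      exact (hτ.comp_fst_prod.add S.odeG.smooth_deriv.comp_snd_prod).sub
        ((S.odeG.smooth_deriv.comp_snd_prod.div hq.comp_snd_prod fun z hz => hq0 z.2 hz.2).div
          hp.comp_fst_prod fun z hz => hp0 z.1 hz.1)
    · refine ContDiffOn.congr (f := fun z : ℝ × ℝ =>
        η z.2 + (p z.1 * deriv S.f z.1 * q z.2 - deriv S.f z.1)) ?_ fun z hz =>
          hB' z.1 hz.1 z.2 hz.2
      exact hη.comp_snd_prod.add (((hp.comp_fst_prod.mul S.odeF.smooth_deriv.comp_fst_prod).mul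
        hq.comp_snd_prod).sub S.odeF.smooth_deriv.comp_fst_prod)
    · intro x hx y hy
      have h1 := hp0 x hx
      have h2 := hk x hx
      rw [dyA x hx y hy, dxB x hx y hy, Ω]
      field_simp
      linear_combination -q y * h2
  refine ⟨hv, (S.separates_iff hv E lam φ).2 ?_⟩
  obtain ⟨σ₁, hσ₁⟩ := S.odeF.exists_first_integral
  obtain ⟨σ₂, hσ₂⟩ := S.odeG.exists_first_integral
  refine ⟨fun _ y => q y, fun x => -((S.hbar : ℂ) ^ 2 / 2) * p x,
    fun x => -(Complex.I * S.hbar) * (p x * τ x),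
    fun x => X x + S.restX c₂ σ₂ lam (p x) (τ x) x
      - Complex.I * S.hbar / 2 * (p x * (deriv τ x : ℝ)),
    fun y => -((S.hbar : ℂ) ^ 2 / 2) / q y, fun y => -(Complex.I * S.hbar) * (η y / q y),
    fun y => Y y + ((S.potentialY σ₁ E lam (η y) y / q y - c₁ * q y / 2 : ℝ) : ℂ)
      - Complex.I * S.hbar / 2 * ((deriv η y : ℝ) / q y),
    fun x hx y hy => Complex.ofReal_ne_zero.2 (hq0 y hy), fun x hx y hy => ?_⟩
  have h1 := hp0 x hx
  have h2 := hq0 y hy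
  have h2' : (q y : ℂ) ≠ 0 := by exact_mod_cast h2
  have hB1 : B x y = η y + (p x * q y - 1) * deriv S.f x := by
    rw [hB' x hx y hy]; ring
  have e1 : (1 + φ x y) * A x y - φ x y * deriv S.g y = q y * (p x * τ x) := by
    rw [hA' x hx y hy, hφ x hx y hy]
    field_simp
    ring
  have e2 : B x y - φ x y * deriv S.f x = η y := by
    rw [hB x hx y hy]; ring
  have e3 : (1 + φ x y) * dx A x y + dy B x y = q y * (p x * deriv τ x + deriv η y / q y) := by
    rw [hφ x hx y hy, dxA x hx y hy, dyB x hx y hy]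
    linear_combination q y * him x hx y hy
      + q y * (deriv S.g y / q y) * deriv p x / p x * mul_inv_cancel₀ h1
      - (p x * deriv S.f x * deriv q y + deriv η y) * mul_inv_cancel₀ h2
  have e4 : S.zerothOrder A B E lam (φ x y) x y
      = q y * (X x + Y y + S.restX c₂ σ₂ lam (p x) (τ x) x
        + (S.potentialY σ₁ E lam (η y) y / q y - c₁ * q y / 2)) := by
    rw [hφ x hx y hy, S.zerothOrder_eq h1 h2 (hσ₁ x hx) (hσ₂ y hy) (hP2 x hx) (hQ2 y hy)
      (hA' x hx y hy) hB1, hre x hx y hy]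
  refine ⟨?_, ?_, ?_, ?_, ?_⟩
  · rw [hφ x hx y hy]
    push_cast
    ring
  · field_simp
  · have := congrArg (fun r : ℝ => (r : ℂ)) e1
    push_cast at this
    rw [this]
    ring
  · have := congrArg (fun r : ℝ => (r : ℂ)) e2
    push_cast at this
    rw [this]
    field_simp
  · have := congrArg (fun r : ℝ => (r : ℂ)) e3
    push_cast at this
    rw [this, e4]
    push_cast
    field_simp
    ring

/-- With φ = -1 the mixed terms are f g'' and g'τ. If g' and g'' are multiples of one nonvanishing
r(y), then ρ = r separates them. A vanishing c is allowed, which covers constant g. -/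
theorem separates_neg_one {E lam κ c : ℝ} {r τ η : ℝ → ℝ}
    (hτ : ContDiffOn ℝ ∞ τ S.I) (hη : ContDiffOn ℝ ∞ η S.J)
    (hr : ∀ y ∈ S.J, r y ≠ 0) (hg1 : ∀ y ∈ S.J, deriv S.g y = c * r y)
    (hg2 : ∀ y ∈ S.J, deriv (deriv S.g) y = κ * r y) :
    S.IsVectorPotential (fun x y => deriv S.g y + τ x) (fun x y => -deriv S.f x + η y) ∧
      S.Separates E lam (fun _ _ => -1)
        (fun x y => deriv S.g y + τ x) (fun x y => -deriv S.f x + η y) := by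
  have hv : S.IsVectorPotential (fun x y => deriv S.g y + τ x)
      (fun x y => -deriv S.f x + η y) := by
    refine ⟨S.odeG.smooth_deriv.comp_snd_prod.add hτ.comp_fst_prod,
      S.odeF.smooth_deriv.comp_fst_prod.neg.add hη.comp_snd_prod, fun x hx y hy => ?_⟩
    simp [dy, dx, Ω, add_comm]
  refine ⟨hv, (S.separates_iff hv E lam _).2 ?_⟩
  obtain ⟨σ₁, hσ₁⟩ := S.odeF.exists_first_integral
  refine ⟨fun _ y => r y, fun _ => 0, fun _ => -(Complex.I * S.hbar) * c,
    fun x => κ * S.f x + c * τ x, fun y => -((S.hbar : ℂ) ^ 2 / 2) / r y,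
    fun y => -(Complex.I * S.hbar) * (η y / r y),
    fun y => (S.potentialY σ₁ E lam (η y) y - Complex.I * S.hbar / 2 * (deriv η y : ℝ)) / r y,
    fun x hx y hy => Complex.ofReal_ne_zero.2 (hr y hy), fun x hx y hy => ?_⟩
  have h1 : (r y : ℂ) ≠ 0 := by exact_mod_cast hr y hy
  have h2 : dy (fun x y => -deriv S.f x + η y) x y = deriv η y := by simp [dy]
  have h3 := S.zerothOrder_neg_one (A := fun x y => deriv S.g y + τ x)
    (B := fun x y => -deriv S.f x + η y) (E := E) (lam := lam) (y := y) (hσ₁ x hx) rfl rfl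
  rw [← S.g_ode y hy, hg2 y hy] at h3
  rw [h2, h3, hg1 y hy]
  push_cast
  refine ⟨by ring, by field_simp, by ring, by field_simp; ring, ?_⟩
  field_simp
  ring

theorem separates_of_case_one_or_two (h : S.Case1 ∨ S.Case2) (E lam : ℝ) {τ η : ℝ → ℝ}
    (hτ : ContDiffOn ℝ ∞ τ S.I) (hη : ContDiffOn ℝ ∞ η S.J) :
    S.IsVectorPotential (fun x y => deriv S.g y + τ x) (fun x y => -deriv S.f x + η y) ∧
      S.Separates E lam (fun _ _ => -1)
        (fun x y => deriv S.g y + τ x) (fun x y => -deriv S.f x + η y) := by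
  rcases h with ⟨hα, hδ, hξ, g₀, g₁, hg⟩ | ⟨hα, hδ, g₁, g₂, h12, hg⟩
  · refine separates_neg_one (r := fun _ => 1) (c := g₀) (κ := 0) hτ hη (by simp)
      (fun y hy => ?_) (fun y hy => ?_)
    · have h1 : HasDerivAt S.g (g₀ * 1) y :=
        (((hasDerivAt_id y).const_mul g₀).add_const g₁).congr_of_eventuallyEq
          (by filter_upwards [S.J_open.mem_nhds hy] with s hs using hg s hs)
      exact h1.deriv
    · rw [S.g_ode y hy, hα, hδ, hξ]; ring
  · obtain ⟨κ, c, hκ, hg'⟩ : ∃ κ c : ℝ, κ ^ 2 = S.δ ∧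
        ∀ y ∈ S.J, S.g y = c * Real.exp (κ * y) - S.ξ / S.δ := by
      have hs := Real.sq_sqrt hδ.le
      rcases mul_eq_zero.1 h12 with h0 | h0
      · exact ⟨-√S.δ, g₂, by rw [neg_sq, hs], fun y hy => by rw [hg y hy, h0]; ring⟩
      · exact ⟨√S.δ, g₁, hs, fun y hy => by rw [hg y hy, h0]; ring⟩
    refine separates_neg_one (r := fun y => Real.exp (κ * y)) (c := c * κ) (κ := c * S.δ) hτ hη
      (fun y _ => (Real.exp_pos _).ne') (fun y hy => ?_) (fun y hy => ?_)
    · have h1 : HasDerivAt S.g (c * (Real.exp (κ * y) * (κ * 1))) y :=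
        ((((hasDerivAt_id y).const_mul κ).exp.const_mul c).sub_const _).congr_of_eventuallyEq
          (by filter_upwards [S.J_open.mem_nhds hy] with s hs using hg' s hs)
      rw [h1.deriv]
      ring
    · rw [S.g_ode y hy, hα, hg' y hy]
      field_simp
      ring

theorem _root_.IsSign.ne_zero {ε : ℝ} (h : IsSign ε) : ε ≠ 0 := by
  rcases h with rfl | rfl <;> norm_num

theorem _root_.IsSign.sq {ε : ℝ} (h : IsSign ε) : ε ^ 2 = 1 := by
  rcases h with rfl | rfl <;> norm_num

theorem IsQuadratic.deriv_eq {x₀ y₀ f₀ g₀ : ℝ} (h : S.IsQuadratic x₀ y₀ f₀ g₀) :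
    (∀ x ∈ S.I, deriv S.f x = S.γ * (x - x₀)) ∧ ∀ y ∈ S.J, deriv S.g y = S.ξ * (y - y₀) := by
  have key : ∀ c d e s : ℝ, HasDerivAt (fun s => c / 2 * (s - d) ^ 2 + e) (c * (s - d)) s := by
    intro c d e s
    refine (((((hasDerivAt_id s).sub_const d).fun_pow 2).const_mul (c / 2)).add_const
      e).congr_deriv ?_
    simp
    ring
  constructor
  · intro x hx
    exact ((key S.γ x₀ f₀ x).congr_of_eventuallyEq
      (by filter_upwards [S.I_open.mem_nhds hx] with s hs using h.1 s hs)).deriv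
  · intro y hy
    exact ((key S.ξ y₀ g₀ y).congr_of_eventuallyEq
      (by filter_upwards [S.J_open.mem_nhds hy] with s hs using h.2 s hs)).deriv

/-- Here p = 1 + φ and q = 1 are constants. The equation Q' = kq fixes k = ξ in the construction,
and p p₁ = -k is then (1 + φ)²γ = -ξ. In the standard form k is arbitrary because it cancels in the
quotient of the radicands, as do x - x₀ and y - y₀ against f' and g'. -/
theorem separates_of_case_three (h : S.Case3) (E lam : ℝ) {ε₁ ε₂ φ : ℝ} {τ η : ℝ → ℝ}
    (h₁ : IsSign ε₁) (h₂ : IsSign ε₂)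
    (hτ : ContDiffOn ℝ ∞ τ S.I) (hη : ContDiffOn ℝ ∞ η S.J)
    (hφ : φ = -1 + ε₁ / ε₂ * √(-S.ξ / S.γ)) :
    S.IsVectorPotential (fun x y => φ / (1 + φ) * deriv S.g y + τ x)
        (fun x y => φ * deriv S.f x + η y) ∧
      S.Separates E lam (fun _ _ => φ) (fun x y => φ / (1 + φ) * deriv S.g y + τ x)
        (fun x y => φ * deriv S.f x + η y) ∧
      ∀ k x₀ y₀ f₀ g₀ : ℝ, k ≠ 0 → S.IsQuadratic x₀ y₀ f₀ g₀ →
        S.StandardForm k (2 * k * f₀) (-(2 * k * g₀)) ε₁ ε₂ τ η (fun _ _ => φ)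
          (fun x y => φ / (1 + φ) * deriv S.g y + τ x) (fun x y => φ * deriv S.f x + η y) := by
  obtain ⟨hα, hβ, hδ, hξγ, x₁, y₁, f₁, g₁, hquad⟩ := h
  have hγ : S.γ ≠ 0 := by rintro h0; simp [h0] at hξγ
  have hξ : S.ξ ≠ 0 := by rintro h0; simp [h0] at hξγ
  have hpos : 0 < -S.ξ / S.γ := by
    rw [show -S.ξ / S.γ = -(S.ξ * S.γ) / S.γ ^ 2 by field_simp]
    have : 0 < -(S.ξ * S.γ) := by linarith
    positivity
  have hp : 1 + φ = ε₁ / ε₂ * √(-S.ξ / S.γ) := by rw [hφ]; ring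
  have hp2 : (1 + φ) ^ 2 = -S.ξ / S.γ := by
    rw [hp, mul_pow, div_pow, h₁.sq, h₂.sq, Real.sq_sqrt hpos.le]; ring
  have hp2' : (1 + φ) ^ 2 * S.γ = -S.ξ := by rw [hp2]; field_simp
  have hp0 : 1 + φ ≠ 0 := by
    intro h0
    rw [h0] at hp2
    rw [← hp2] at hpos
    simp at hpos
  obtain ⟨hf1, hg1⟩ := hquad.deriv_eq
  refine and_assoc.1 ⟨?_, ?_⟩
  · refine separates_of_factors (p := fun _ => 1 + φ) (q := fun _ => 1) (τ := τ) (η := η)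
      (p₁ := fun _ => (1 + φ) * S.γ) (k := S.ξ) (c₁ := 2 * S.ξ * f₁) (c₂ := -(2 * S.ξ * g₁))
      (X := fun x => S.f x * (2 * S.ξ)) (Y := fun y => S.g y * ((1 + φ) * S.γ - S.ξ / (1 + φ)))
      contDiffOn_const contDiffOn_const hτ hη (fun _ _ => hp0) (fun _ _ => one_ne_zero)
      (fun x hx => ?_) (fun x hx => ?_) (fun y hy => ?_) (fun x hx => ?_) (fun y hy => ?_)
      (fun x hx y hy => ?_) (fun x hx y hy => ?_) (fun x hx y hy => ?_) (fun x hx y hy => ?_)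
      (fun x hx y hy => ?_)
    · refine ((S.odeF.hasDerivAt_deriv hx).const_mul (1 + φ)).congr_deriv ?_
      rw [hα, hβ]; ring
    · linear_combination hp2'
    · simp only [div_one]
      refine (S.odeG.hasDerivAt_deriv hy).congr_deriv ?_
      rw [hα, hδ]; ring
    · rw [hf1 x hx, hquad.1 x hx]
      linear_combination S.γ * (x - x₁) ^ 2 * hp2'
    · rw [hg1 y hy, hquad.2 y hy]; ring
    · rw [hα, hβ, hδ]; ring
    · simp
    · ring
    · ring
    · ring
  · intro k x₀ y₀ f₀ g₀ hk hq x hx y hy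
    obtain ⟨hf2, hg2⟩ := hq.deriv_eq
    refine ⟨fun hfx hgy => ?_, by ring, by ring⟩
    rw [hf2 x hx] at hfx ⊢
    rw [hg2 y hy] at hgy ⊢
    have hx0 : x - x₀ ≠ 0 := right_ne_zero_of_mul hfx
    have hy0 : y - y₀ ≠ 0 := right_ne_zero_of_mul hgy
    have ef : 2 * k * f₀ - 2 * k * S.f x = -(k * S.γ * (x - x₀) ^ 2) := by
      rw [hq.1 x hx]; ring
    have eg : -(2 * k * g₀) + 2 * k * S.g y = k * S.ξ * (y - y₀) ^ 2 := by
      rw [hq.2 y hy]; ring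
    rw [ef, eg]
    constructor
    · rw [show -(k * S.γ * (x - x₀) ^ 2) * (k * S.ξ * (y - y₀) ^ 2)
        = -(S.ξ * S.γ) * (k * (x - x₀) * (y - y₀)) ^ 2 by ring]
      have : 0 < -(S.ξ * S.γ) := by linarith
      positivity
    · rw [hp, mul_assoc, ← Real.sqrt_mul' _ (by positivity)]
      congr 2
      field_simp

end CartesianSystem

/-! ### Cubics with a double root and their Riccati equation -/

namespace IsRiccati

variable {I : Set ℝ} {f : ℝ → ℝ} {α β γ t₁ t₂ : ℝ}

theorem neg (h : IsRiccati I f α t₁ t₂) :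
    IsRiccati I (fun x => -f x) (-α) (-t₁) (-t₂) := by
  obtain ⟨U, hU⟩ := h
  refine ⟨fun x => -U x, fun x hx => ?_⟩
  obtain ⟨h1, h2, h3⟩ := hU x hx
  refine ⟨h1.neg.congr_deriv (by ring), by linear_combination -h2, fun h4 => h3 (neg_inj.1 h4)⟩

theorem exists_deriv_eq (hI : IsOpen I) (h : IsRiccati I f α t₁ t₂) :
    ∃ U : ℝ → ℝ, ∀ x ∈ I, HasDerivAt U (f x - t₂) x ∧ f x = t₁ + α / 6 * U x ^ 2 ∧
      f x ≠ t₂ ∧ deriv f x = α / 3 * U x * (f x - t₂) := by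
  obtain ⟨U, hU⟩ := h
  refine ⟨U, fun x hx => ?_⟩
  obtain ⟨h1, h2, h3⟩ := hU x hx
  refine ⟨h1, h2, h3, ?_⟩
  have h4 : HasDerivAt f (α / 3 * U x * (f x - t₂)) x := by
    refine ((((h1.fun_pow 2).const_mul (α / 6)).const_add t₁).congr_of_eventuallyEq
      ?_).congr_deriv ?_
    · filter_upwards [hI.mem_nhds hx] with s hs using (hU s hs).2.1
    · push_cast
      ring
  exact h4.deriv

theorem deriv_sq (hI : IsOpen I) (h : IsRiccati I f α t₁ t₂) :
    ∀ x ∈ I, deriv f x ^ 2 = 2 / 3 * α * (f x - t₁) * (f x - t₂) ^ 2 := by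
  obtain ⟨U, hU⟩ := h.exists_deriv_eq hI
  intro x hx
  obtain ⟨-, h2, -, h4⟩ := hU x hx
  rw [h4]
  linear_combination -(2 / 3) * α * (f x - t₂) ^ 2 * h2

/-- A constant f would give U(f - t₂) = 0, so U = 0 on the interval, contradicting U' = f - t₂ ≠ 0.
-/
theorem nonconst (hI : IsOpen I) (hne : I.Nonempty) (h : IsRiccati I f α t₁ t₂) (hα : α ≠ 0) :
    ¬ ∃ c, ∀ x ∈ I, f x = c := by
  rintro ⟨c, hc⟩
  obtain ⟨U, hU⟩ := h.exists_deriv_eq hI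
  have hU0 : ∀ x ∈ I, U x = 0 := by
    intro x hx
    have h1 : deriv f x = 0 := by
      have h5 : HasDerivAt f 0 x := (hasDerivAt_const x c).congr_of_eventuallyEq
        (by filter_upwards [hI.mem_nhds hx] with s hs using hc s hs)
      exact h5.deriv
    obtain ⟨-, -, h3, h4⟩ := hU x hx
    rw [h1] at h4
    have h5 := sub_ne_zero.2 h3
    have h6 : U x * (α / 3 * (f x - t₂)) = 0 := by linear_combination -h4
    exact (mul_eq_zero.1 h6).resolve_right (by positivity)
  obtain ⟨x, hx⟩ := hne
  obtain ⟨h1, -, h3, -⟩ := hU x hx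
  refine h3 (sub_eq_zero.1 (h1.unique ((hasDerivAt_const x (0 : ℝ)).congr_of_eventuallyEq ?_)))
  filter_upwards [hI.mem_nhds hx] with s hs using hU0 s hs

/-- The coefficients of the differential equation in terms of the two roots. -/
theorem coeffs (h : IsRiccati I f α t₁ t₂) (ho : QuadraticODE I α β γ f)
    (hn : ¬ ∃ c, ∀ x ∈ I, f x = c) :
    β = -(2 * α / 3) * (t₁ + 2 * t₂) ∧ γ = α / 3 * t₂ ^ 2 + 2 * α / 3 * (t₁ * t₂) := by
  obtain ⟨U, hU⟩ := h.exists_deriv_eq ho.isOpen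
  have key : ∀ x ∈ I, α * f x ^ 2 + β * f x + γ
      = α / 3 * (f x - t₂) ^ 2 + 2 * α / 3 * (f x - t₁) * (f x - t₂) := by
    intro x hx
    obtain ⟨h1, h2, h3, h4⟩ := hU x hx
    have h5 : HasDerivAt (deriv f)
        (α / 3 * (f x - t₂) * (f x - t₂) + α / 3 * U x * (deriv f x)) x :=
      ((h1.const_mul (α / 3)).fun_mul ((ho.hasDerivAt hx).sub_const t₂)).congr_of_eventuallyEq
        (by filter_upwards [ho.isOpen.mem_nhds hx] with s hs using (hU s hs).2.2.2)
    rw [(ho.hasDerivAt_deriv hx).unique h5, h4]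
    linear_combination -(2 * α / 3) * (f x - t₂) * h2
  obtain ⟨-, -, -, e1, e0⟩ := coeffs_eq_zero ho.ordConnected ho.continuousOn hn
    (a₄ := 0) (a₃ := 0) (a₂ := 0) (a₁ := β + 2 * α / 3 * (t₁ + 2 * t₂))
    (a₀ := γ - (α / 3 * t₂ ^ 2 + 2 * α / 3 * (t₁ * t₂)))
    (fun x hx => by linear_combination key x hx)
  exact ⟨by linarith, by linarith⟩

/-- The nonconstant f determines the cubic (t - t₁)(t - t₂)², and a cubic determines its roots with
multiplicity. This identifies the double root found from a separating triple with the one read off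
from the tables. -/
theorem unique {s₁ s₂ : ℝ} (h : IsRiccati I f α t₁ t₂) (h' : IsRiccati I f α s₁ s₂)
    (hα : α ≠ 0) (hI : IsOpen I) (hc : I.OrdConnected) (hf : ContinuousOn f I)
    (hn : ¬ ∃ c, ∀ x ∈ I, f x = c) : t₁ = s₁ ∧ t₂ = s₂ := by
  obtain ⟨-, -, e2, e1, e0⟩ := coeffs_eq_zero hc hf hn (a₄ := 0) (a₃ := 0)
    (a₂ := (t₁ + 2 * t₂) - (s₁ + 2 * s₂))
    (a₁ := (s₂ ^ 2 + 2 * s₁ * s₂) - (t₂ ^ 2 + 2 * t₁ * t₂)) (a₀ := t₁ * t₂ ^ 2 - s₁ * s₂ ^ 2)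
    (fun x hx => by
      have h1 := h.deriv_sq hI x hx
      rw [h'.deriv_sq hI x hx] at h1
      apply mul_left_cancel₀ hα
      linear_combination (3 / 2) * h1)
  have ht₁ : t₁ = s₁ + 2 * s₂ - 2 * t₂ := by linarith
  subst ht₁
  have h2 : t₂ = s₂ := by
    by_contra hne
    have hd := sub_ne_zero.2 hne
    have e3 : 2 * s₁ + s₂ - 3 * t₂ = 0 := by
      apply mul_left_cancel₀ hd
      linear_combination -e1
    have e4 : (t₂ - s₂) ^ 3 = 0 := by
      have hs₁ : s₁ = (3 * t₂ - s₂) / 2 := by linarith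
      rw [hs₁] at e0
      linear_combination -2 * e0
    exact hd (pow_eq_zero_iff (by norm_num) |>.1 e4)
  exact ⟨by rw [h2]; ring, h2⟩

end IsRiccati

/-! ### The tables as solutions of the Riccati equation -/

theorem omega_sq (D : ℝ) : omega D ^ 2 = √D / 4 := Real.sq_sqrt (by positivity)

theorem omega_pos {D : ℝ} (hD : 0 < D) : 0 < omega D := by
  unfold omega
  have := Real.sqrt_pos.2 hD
  positivity

theorem width_pos {α D : ℝ} (hα : 0 < α) (hD : 0 < D) : 0 < width α D := by
  have := omega_pos hD
  unfold width
  positivity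

theorem width_mul {α D : ℝ} (hα : 0 < α) : α * width α D = 6 * omega D ^ 2 := by
  unfold width
  field_simp

/-- The sign of `α (f - t₂)` for the double root `t₂`. -/
def Row.sgn : Row → ℝ
  | .three => -1
  | _ => 1

/-- The row of the first table that corresponds to a row of the second one. -/
def Row.swap : Row → Row
  | .one => .one
  | .two => .four
  | .three => .three
  | .four => .two

/-- In the four rows U is a negative multiple of 1/(x - x₀), cot, tanh, coth respectively. The
double root t₂ equals t₁ in the first row, t₁ - w in the second and t₁ + w in the others, where w is
the width. Only the tanh solution lies below t₂. -/
theorem isRiccati_tableF {I : Set ℝ} {f : ℝ → ℝ} {α β γ x₀ : ℝ} {r : Row} (hα : 0 < α)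
    (hD : r ≠ .one → 0 < β ^ 2 - 4 * α * γ)
    (hf : ∀ x ∈ I, regularF r (β ^ 2 - 4 * α * γ) x₀ x ∧ f x = tableF r α β γ x₀ x) :
    ∃ t₂, IsRiccati I f α (tableFRoot r α β γ) t₂ ∧ ∀ x ∈ I, 0 < r.sgn * (f x - t₂) := by
  set D := β ^ 2 - 4 * α * γ with hDdef
  cases r with
  | one =>
    simp only [regularF, tableF] at hf
    have hsub : ∀ x ∈ I, f x - -β / (2 * α) = 6 / (α * (x - x₀) ^ 2) := fun x hx => by
      rw [(hf x hx).2]; ring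
    have hpos : ∀ x ∈ I, 0 < 6 / (α * (x - x₀) ^ 2) := fun x hx => by
      have := sub_ne_zero.2 (hf x hx).1
      positivity
    refine ⟨-β / (2 * α), ⟨fun x => -(6 / α) / (x - x₀), fun x hx => ⟨?_, ?_, ?_⟩⟩,
      fun x hx => ?_⟩
    · have h0 := sub_ne_zero.2 (hf x hx).1
      refine ((hasDerivAt_const x (-(6 / α))).fun_div ((hasDerivAt_id x).sub_const x₀)
        h0).congr_deriv ?_
      rw [hsub x hx]
      simp only [id]
      field_simp
      ring
    · have h0 := sub_ne_zero.2 (hf x hx).1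
      simp only [tableFRoot]
      rw [← sub_eq_iff_eq_add', hsub x hx]
      field_simp
    · rw [← sub_ne_zero, hsub x hx]
      exact (hpos x hx).ne'
    · rw [hsub x hx]
      simpa [Row.sgn] using hpos x hx
  | two =>
    have hD := hD (by simp)
    have hw := width_pos hα hD
    have hω := omega_pos hD
    have hαw := width_mul (D := D) hα
    simp only [regularF, tableF, ← hDdef] at hf
    simp only [tableFRoot, ← hDdef]
    generalize width α D = w at hf hw hαw ⊢
    generalize omega D = o at hf hω hαw ⊢
    generalize (-β - √D) / (2 * α) = t at hf ⊢
    have hpos : ∀ x ∈ I, 0 < w / Real.sin (o * (x - x₀)) ^ 2 := fun x hx => by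
      have := (hf x hx).1
      positivity
    refine ⟨t, ⟨fun x => -(w / o) * (Real.cos (o * (x - x₀)) / Real.sin (o * (x - x₀))),
      fun x hx => ⟨?_, ?_, ?_⟩⟩, fun x hx => ?_⟩
    · have h0 := (hf x hx).1
      have hl : HasDerivAt (fun s => o * (s - x₀)) (o * 1) x :=
        ((hasDerivAt_id x).sub_const x₀).const_mul o
      refine ((hl.cos.fun_div hl.sin h0).const_mul (-(w / o))).congr_deriv ?_
      rw [(hf x hx).2]
      field_simp
      linear_combination w * Real.sin_sq_add_cos_sq (o * (x - x₀))
    · have h0 := (hf x hx).1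
      rw [(hf x hx).2]
      field_simp
      linear_combination -w * Real.cos (o * (x - x₀)) ^ 2 * hαw
        - 6 * o ^ 2 * w * Real.sin_sq_add_cos_sq (o * (x - x₀))
    · rw [(hf x hx).2]
      linarith [hpos x hx]
    · rw [(hf x hx).2]
      simpa [Row.sgn] using hpos x hx
  | three =>
    have hD := hD (by simp)
    have hw := width_pos hα hD
    have hω := omega_pos hD
    have hαw := width_mul (D := D) hα
    simp only [regularF, tableF, ← hDdef] at hf
    simp only [tableFRoot, ← hDdef]
    generalize width α D = w at hf hw hαw ⊢
    generalize omega D = o at hf hω hαw ⊢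
    generalize (-β + √D) / (2 * α) - w = t at hf ⊢
    have hsub : ∀ x ∈ I, f x - (t + w) = -(w / Real.cosh (o * (x - x₀)) ^ 2) := fun x hx => by
      have h0 := (Real.cosh_pos (o * (x - x₀))).ne'
      rw [(hf x hx).2, Real.tanh_eq_sinh_div_cosh]
      field_simp
      linear_combination -w * Real.cosh_sq_sub_sinh_sq (o * (x - x₀))
    have hpos : ∀ x ∈ I, 0 < w / Real.cosh (o * (x - x₀)) ^ 2 := fun x hx => by
      have := Real.cosh_pos (o * (x - x₀))
      positivity
    refine ⟨t + w, ⟨fun x => -(w / o) * (Real.sinh (o * (x - x₀)) / Real.cosh (o * (x - x₀))),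
      fun x hx => ⟨?_, ?_, ?_⟩⟩, fun x hx => ?_⟩
    · have h0 := (Real.cosh_pos (o * (x - x₀))).ne'
      have hl : HasDerivAt (fun s => o * (s - x₀)) (o * 1) x :=
        ((hasDerivAt_id x).sub_const x₀).const_mul o
      refine ((hl.sinh.fun_div hl.cosh h0).const_mul (-(w / o))).congr_deriv ?_
      rw [hsub x hx]
      field_simp
      linear_combination -Real.cosh_sq_sub_sinh_sq (o * (x - x₀))
    · rw [(hf x hx).2, Real.tanh_eq_sinh_div_cosh]
      have h0 := (Real.cosh_pos (o * (x - x₀))).ne'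
      field_simp
      linear_combination -w * Real.sinh (o * (x - x₀)) ^ 2 * hαw
    · rw [← sub_ne_zero, hsub x hx]
      exact neg_ne_zero.2 (hpos x hx).ne'
    · rw [hsub x hx]
      simpa [Row.sgn] using hpos x hx
  | four =>
    have hD := hD (by simp)
    have hw := width_pos hα hD
    have hω := omega_pos hD
    have hαw := width_mul (D := D) hα
    simp only [regularF, tableF, ← hDdef] at hf
    simp only [tableFRoot, ← hDdef]
    generalize width α D = w at hf hw hαw ⊢
    generalize omega D = o at hf hω hαw ⊢
    generalize (-β + √D) / (2 * α) - w = t at hf ⊢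
    have hs0 : ∀ x ∈ I, Real.sinh (o * (x - x₀)) ≠ 0 := fun x hx => by
      rw [Ne, Real.sinh_eq_zero]
      exact mul_ne_zero hω.ne' (sub_ne_zero.2 (hf x hx).1)
    have hsub : ∀ x ∈ I, f x - (t + w) = w / Real.sinh (o * (x - x₀)) ^ 2 := fun x hx => by
      have h0 := (Real.cosh_pos (o * (x - x₀))).ne'
      have h1 := hs0 x hx
      rw [(hf x hx).2, Real.tanh_eq_sinh_div_cosh]
      field_simp
      linear_combination w * Real.cosh_sq_sub_sinh_sq (o * (x - x₀))
    have hpos : ∀ x ∈ I, 0 < w / Real.sinh (o * (x - x₀)) ^ 2 := fun x hx => by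
      have := hs0 x hx
      positivity
    refine ⟨t + w, ⟨fun x => -(w / o) * (Real.cosh (o * (x - x₀)) / Real.sinh (o * (x - x₀))),
      fun x hx => ⟨?_, ?_, ?_⟩⟩, fun x hx => ?_⟩
    · have h0 := hs0 x hx
      have hl : HasDerivAt (fun s => o * (s - x₀)) (o * 1) x :=
        ((hasDerivAt_id x).sub_const x₀).const_mul o
      refine ((hl.cosh.fun_div hl.sinh h0).const_mul (-(w / o))).congr_deriv ?_
      rw [hsub x hx]
      field_simp
      linear_combination Real.cosh_sq_sub_sinh_sq (o * (x - x₀))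
    · rw [(hf x hx).2, Real.tanh_eq_sinh_div_cosh]
      have h0 := (Real.cosh_pos (o * (x - x₀))).ne'
      have h1 := hs0 x hx
      field_simp
      linear_combination -w * Real.cosh (o * (x - x₀)) ^ 2 * hαw
    · rw [← sub_ne_zero, hsub x hx]
      exact (hpos x hx).ne'
    · rw [hsub x hx]
      simpa [Row.sgn] using hpos x hx

/-- The autonomous equation U' = t₁ - t₂ + (α/6)U² is integrated explicitly. The order of t₁ and t₂
decides between a logarithm, a reciprocal and an arctangent, and D = (2α(t₁ - t₂)/3)² identifies the
constants of the tables. -/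
theorem IsRiccati.exists_tableF {I : Set ℝ} {f : ℝ → ℝ} {α β γ t₁ t₂ : ℝ} (hα : 0 < α)
    (hI : IsOpen I) (hc : I.OrdConnected) (h : IsRiccati I f α t₁ t₂)
    (hβ : β = -(2 * α / 3) * (t₁ + 2 * t₂))
    (hγ : γ = α / 3 * t₂ ^ 2 + 2 * α / 3 * (t₁ * t₂)) :
    ∃ r : Row, (r ≠ .one → 0 < β ^ 2 - 4 * α * γ) ∧ ∃ x₀, ∀ x ∈ I,
      regularF r (β ^ 2 - 4 * α * γ) x₀ x ∧ f x = tableF r α β γ x₀ x := by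
  obtain ⟨U, hU⟩ := h
  have hDt : β ^ 2 - 4 * α * γ = (2 * α / 3 * (t₁ - t₂)) ^ 2 := by rw [hβ, hγ]; ring
  rcases lt_trichotomy t₁ t₂ with hlt | heq | hgt
  · obtain ⟨w, hw⟩ : ∃ w, w = t₂ - t₁ := ⟨_, rfl⟩
    have hw0 : 0 < w := by linarith
    have hDw : β ^ 2 - 4 * α * γ = (2 * α / 3 * w) ^ 2 := by rw [hDt, hw]; ring
    have hD : 0 < β ^ 2 - 4 * α * γ := by rw [hDw]; positivity
    have hs : √(β ^ 2 - 4 * α * γ) = 2 * α / 3 * w := by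
      rw [hDw, Real.sqrt_sq (by positivity)]
    have hwid : width α (β ^ 2 - 4 * α * γ) = w := by
      rw [width, omega_sq, hs]; field_simp; ring
    have hαw := width_mul (D := β ^ 2 - 4 * α * γ) hα
    have hω := omega_pos hD
    have hroot : (-β + √(β ^ 2 - 4 * α * γ)) / (2 * α) - w = t₁ := by
      rw [hs, hβ, hw]; field_simp; ring
    simp only [regularF, tableF]
    obtain ⟨o, ho⟩ : ∃ o, o = omega (β ^ 2 - 4 * α * γ) := ⟨_, rfl⟩
    rw [hwid, ← ho] at hαw
    rw [← ho] at hω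
    -- In terms of z = oU/w one has f = t₁ + w z², so z = ±1 would mean f = t₂.
    have hz : ∀ x ∈ I, o * U x / w - 1 ≠ 0 ∧ o * U x / w + 1 ≠ 0 := by
      intro x hx
      obtain ⟨-, h2, h3⟩ := hU x hx
      have h4 : (o * U x / w - 1) * (o * U x / w + 1) ≠ 0 := by
        intro h5
        apply h3
        field_simp at h5
        have h6 : w * (f x - t₂) = 0 := by
          rw [h2, hw]
          rw [hw] at h5 hαw
          linear_combination h5 + U x ^ 2 / 6 * hαw
        linarith [(mul_eq_zero.1 h6).resolve_left hw0.ne']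
      exact ⟨left_ne_zero_of_mul h4, right_ne_zero_of_mul h4⟩
    -- This is the integral of z' = o(z² - 1).
    obtain ⟨C, hC⟩ := exists_eq_const hI hc
      (F := fun x => (o * U x / w - 1) / (o * U x / w + 1) * Real.exp (-(2 * o * x)))
      (fun x hx => by
        obtain ⟨h1, h2, h3⟩ := hU x hx
        have h4 : HasDerivAt (fun s => o * U s / w) (o * (f x - t₂) / w) x :=
          (h1.const_mul o).div_const w
        have h5 : HasDerivAt (fun s => Real.exp (-(2 * o * s)))
            (Real.exp (-(2 * o * x)) * -(2 * o * 1)) x :=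
          ((hasDerivAt_id x).const_mul (2 * o)).neg.exp
        have h6 : o * (f x - t₂) / w = o * ((o * U x / w) ^ 2 - 1) := by
          rw [h2, show t₂ = t₁ + w by linarith]
          field_simp
          linear_combination U x ^ 2 * hαw
        refine (((h4.sub_const 1).fun_div (h4.add_const 1) (hz x hx).2).fun_mul h5).congr_deriv ?_
        rw [h6]
        have := (hz x hx).2
        generalize o * U x / w = z at *
        field_simp
        ring)
    have hf : ∀ x ∈ I, f x = t₁ + w * (o * U x / w) ^ 2 := by
      intro x hx
      rw [(hU x hx).2.1]
      field_simp
      linear_combination U x ^ 2 * hαw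
    rcases I.eq_empty_or_nonempty with rfl | ⟨x₁, hx₁⟩
    · exact ⟨.one, by simp⟩
    have hC0 : C ≠ 0 := by
      rw [← hC x₁ hx₁]
      exact mul_ne_zero (div_ne_zero (hz x₁ hx₁).1 (hz x₁ hx₁).2) (Real.exp_pos _).ne'
    obtain ⟨x₀, hx₀⟩ : ∃ x₀, Real.exp (-(2 * o * x₀)) = |C| :=
      ⟨-Real.log |C| / (2 * o), by
        rw [show -(2 * o * (-Real.log |C| / (2 * o))) = Real.log |C| by field_simp,
          Real.exp_log (abs_pos.2 hC0)]⟩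
    have hkey : ∀ x ∈ I, o * U x / w - 1
        = C / |C| * Real.exp (o * (x - x₀)) ^ 2 * (o * U x / w + 1) := by
      intro x hx
      have h1 := hC x hx
      have h2 := (hz x hx).2
      have h3 : Real.exp (o * (x - x₀)) ^ 2 = Real.exp (2 * o * x) * |C| := by
        rw [← hx₀, ← Real.exp_add, ← Real.exp_nat_mul]
        congr 1
        push_cast
        ring
      have h4 : Real.exp (-(2 * o * x)) * Real.exp (2 * o * x) = 1 := by
        rw [← Real.exp_add]; simp
      have h5 : C / |C| * (Real.exp (2 * o * x) * |C|) = C * Real.exp (2 * o * x) := by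
        have := abs_ne_zero.2 hC0
        field_simp
      rw [h3, h5, ← h1]
      generalize o * U x / w = z at *
      field_simp
      linear_combination (1 - z) * h4
    have htanh : ∀ y, Real.tanh y = (Real.exp y ^ 2 - 1) / (Real.exp y ^ 2 + 1) := by
      intro y
      have := Real.exp_pos y
      rw [Real.tanh_eq_sinh_div_cosh, Real.sinh_eq, Real.cosh_eq, Real.exp_neg]
      field_simp
    -- The sign of C tells whether |z| < 1 or |z| > 1; solving for z gives -tanh or -coth of o(x -
    -- x₀).
    rcases lt_or_gt_of_ne hC0 with hneg | hpos
    · refine ⟨.three, fun _ => hD, x₀, fun x hx => ⟨trivial, ?_⟩⟩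
      have h1 := hkey x hx
      rw [abs_of_neg hneg, div_neg, div_self hC0] at h1
      simp only [← ho, hwid, hroot]
      rw [htanh, hf x hx]
      have h2 : 0 < Real.exp (o * (x - x₀)) ^ 2 + 1 := by positivity
      generalize Real.exp (o * (x - x₀)) ^ 2 = a at *
      have h3 : o * U x / w = -((a - 1) / (a + 1)) := by
        generalize o * U x / w = z at *
        field_simp
        linear_combination h1
      rw [h3, neg_sq]
    · refine ⟨.four, fun _ => hD, x₀, fun x hx => ?_⟩
      have h1 := hkey x hx
      rw [abs_of_pos hpos, div_self hC0] at h1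
      simp only [← ho, hwid, hroot]
      rw [htanh, hf x hx]
      have hx0 : x ≠ x₀ := by
        rintro rfl
        simp at h1
        linarith
      refine ⟨hx0, ?_⟩
      have h2 : 0 < Real.exp (o * (x - x₀)) ^ 2 + 1 := by positivity
      have h4 : Real.exp (o * (x - x₀)) ^ 2 - 1 ≠ 0 := by
        intro h5
        rw [sub_eq_zero.1 h5] at h1
        linarith
      generalize Real.exp (o * (x - x₀)) ^ 2 = a at *
      have h3 : o * U x / w = -((a + 1) / (a - 1)) := by
        generalize o * U x / w = z at *
        field_simp
        linear_combination -h1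
      rw [h3]
      field_simp
  · subst heq
    refine ⟨.one, by simp, ?_⟩
    have hU0 : ∀ x ∈ I, U x ≠ 0 := by
      intro x hx h0
      obtain ⟨-, h2, h3⟩ := hU x hx
      rw [h0] at h2
      apply h3
      linarith
    obtain ⟨c, hc⟩ := exists_eq_const hI hc (F := fun x => 1 / U x + α / 6 * x) (fun x hx => by
      obtain ⟨h1, h2, h3⟩ := hU x hx
      have h0 := hU0 x hx
      refine (((hasDerivAt_const x (1 : ℝ)).fun_div h1 h0).fun_add
        ((hasDerivAt_id x).const_mul (α / 6))).congr_deriv ?_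
      rw [h2]
      field_simp
      ring)
    refine ⟨6 * c / α, fun x hx => ?_⟩
    have h0 := hU0 x hx
    have h1 : 1 / U x = -(α / 6) * (x - 6 * c / α) := by
      rw [show 1 / U x = c - α / 6 * x by linarith [hc x hx]]
      field_simp
      ring
    have h2 : x - 6 * c / α ≠ 0 := by
      intro h3
      rw [h3, mul_zero] at h1
      exact one_div_ne_zero h0 h1
    refine ⟨sub_ne_zero.1 h2, ?_⟩
    have h4 : U x = 1 / (-(α / 6) * (x - 6 * c / α)) := by rw [← h1]; simp
    simp only [tableF]
    rw [(hU x hx).2.1, h4, hβ]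
    generalize x - 6 * c / α = s at *
    field_simp
    ring
  · obtain ⟨w, hw⟩ : ∃ w, w = t₁ - t₂ := ⟨_, rfl⟩
    have hw0 : 0 < w := by linarith
    have hDw : β ^ 2 - 4 * α * γ = (2 * α / 3 * w) ^ 2 := by rw [hDt, hw]
    have hD : 0 < β ^ 2 - 4 * α * γ := by rw [hDw]; positivity
    have hs : √(β ^ 2 - 4 * α * γ) = 2 * α / 3 * w := by
      rw [hDw, Real.sqrt_sq (by positivity)]
    have hwid : width α (β ^ 2 - 4 * α * γ) = w := by
      rw [width, omega_sq, hs]; field_simp; ring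
    have hαw := width_mul (D := β ^ 2 - 4 * α * γ) hα
    have hω := omega_pos hD
    have hroot : (-β - √(β ^ 2 - 4 * α * γ)) / (2 * α) = t₂ := by
      rw [hs, hβ, hw]; field_simp; ring
    refine ⟨.two, fun _ => hD, ?_⟩
    simp only [regularF, tableF, hwid, hroot]
    generalize omega (β ^ 2 - 4 * α * γ) = o at *
    rw [hwid] at hαw
    -- Now z = oU/w satisfies z' = o(1 + z²), so z = tan(ox + c). The shift by π/2 in x₀ below turns
    -- the cosine of this argument into the sine of the table.
    obtain ⟨c, hc⟩ := exists_eq_const hI hc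
      (F := fun x => Real.arctan (o * U x / w) - o * x) (fun x hx => by
        obtain ⟨h1, h2, h3⟩ := hU x hx
        refine ((((h1.const_mul o).div_const w).arctan).fun_sub
          ((hasDerivAt_id x).const_mul o)).congr_deriv ?_
        have h4 : 1 + (o * U x / w) ^ 2 = (f x - t₂) / w := by
          rw [h2, show t₂ = t₁ - w by linarith]
          field_simp
          linear_combination -U x ^ 2 * hαw
        have h5 := sub_ne_zero.2 h3
        rw [h4]
        field_simp
        ring)
    refine ⟨-(c + Real.pi / 2) / o, fun x hx => ?_⟩
    have h1 : Real.sin (o * (x - -(c + Real.pi / 2) / o)) = Real.cos (Real.arctan (o * U x / w)) := by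
      rw [show o * (x - -(c + Real.pi / 2) / o) = (o * x + c) + Real.pi / 2 by field_simp; ring,
        Real.sin_add_pi_div_two, ← hc x hx]
      congr 1
      ring
    rw [h1]
    refine ⟨(Real.cos_arctan_pos _).ne', ?_⟩
    rw [Real.cos_sq_arctan, (hU x hx).2.1, show t₂ = t₁ - w by linarith]
    field_simp
    linear_combination U x ^ 2 * hαw

/-- The rows of the first table, for `α` of either sign. -/
def IsTableSolution (I : Set ℝ) (f : ℝ → ℝ) (α β γ : ℝ) (r : Row) : Prop :=
  (r ≠ .one → 0 < β ^ 2 - 4 * α * γ) ∧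
  ((0 < α ∧ ∃ x₀, ∀ x ∈ I, regularF r (β ^ 2 - 4 * α * γ) x₀ x ∧ f x = tableF r α β γ x₀ x) ∨
   (α < 0 ∧ ∃ x₀, ∀ x ∈ I,
      regularF r (β ^ 2 - 4 * α * γ) x₀ x ∧ -f x = tableF r (-α) β (-γ) x₀ x))

/-- The simple root for the rows of the first table, for `α` of either sign. -/
def simpleRoot (r : Row) (α β γ : ℝ) : ℝ :=
  if 0 < α then tableFRoot r α β γ else -tableFRoot r (-α) β (-γ)

/-- The product α(f - t₂) is unchanged when f, α and t₂ all change sign, so its sign depends on the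
row alone and the case α < 0 reduces to α > 0. -/
theorem IsTableSolution.exists_isRiccati {I : Set ℝ} {f : ℝ → ℝ} {α β γ : ℝ} {r : Row}
    (h : IsTableSolution I f α β γ r) :
    ∃ t₂, IsRiccati I f α (simpleRoot r α β γ) t₂ ∧ ∀ x ∈ I, 0 < r.sgn * (α * (f x - t₂)) := by
  obtain ⟨hD, ⟨hα, x₀, hf⟩ | ⟨hα, x₀, hf⟩⟩ := h
  · obtain ⟨t₂, h1, h2⟩ := isRiccati_tableF hα hD hf
    refine ⟨t₂, by rwa [simpleRoot, if_pos hα], fun x hx => ?_⟩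
    have := mul_pos hα (h2 x hx)
    linarith
  · have hDD : β ^ 2 - 4 * (-α) * (-γ) = β ^ 2 - 4 * α * γ := by ring
    obtain ⟨t₂, h1, h2⟩ := isRiccati_tableF (I := I) (f := fun x => -f x) (α := -α) (β := β)
      (γ := -γ) (r := r) (x₀ := x₀) (by linarith) (by rwa [hDD]) (by rwa [hDD])
    refine ⟨-t₂, ?_, fun x hx => ?_⟩
    · rw [simpleRoot, if_neg hα.not_gt]
      simpa using h1.neg
    · have := mul_pos (neg_pos.2 hα) (h2 x hx)
      linarith

theorem IsRiccati.exists_isTableSolution {I : Set ℝ} {f : ℝ → ℝ} {α β γ t₁ t₂ : ℝ}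
    (h : IsRiccati I f α t₁ t₂) (hα : α ≠ 0) (ho : QuadraticODE I α β γ f)
    (hn : ¬ ∃ c, ∀ x ∈ I, f x = c) : ∃ r, IsTableSolution I f α β γ r := by
  obtain ⟨hβ, hγ⟩ := h.coeffs ho hn
  rcases lt_or_gt_of_ne hα with hneg | hpos
  · have hDD : β ^ 2 - 4 * (-α) * (-γ) = β ^ 2 - 4 * α * γ := by ring
    obtain ⟨r, h1, x₀, h2⟩ := h.neg.exists_tableF (β := β) (γ := -γ) (neg_pos.2 hneg) ho.isOpen
      ho.ordConnected (by rw [hβ]; ring) (by rw [hγ]; ring)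
    rw [hDD] at h1 h2
    exact ⟨r, h1, Or.inr ⟨hneg, x₀, h2⟩⟩
  · obtain ⟨r, h1, h2⟩ := h.exists_tableF hpos ho.isOpen ho.ordConnected hβ hγ
    exact ⟨r, h1, Or.inl ⟨hpos, h2⟩⟩

theorem Row.swap_swap (r : Row) : r.swap.swap = r := by cases r <;> rfl

theorem Row.sgn_swap (r : Row) : r.swap.sgn = r.sgn := by cases r <;> rfl

theorem Row.sgn_sq (r : Row) : r.sgn ^ 2 = 1 := by cases r <;> simp [Row.sgn]

/-- If g solves the second equation, -g solves the first with constants α, δ, -ξ. Under this the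
second table becomes the first with rows two and four exchanged, so no separate analysis of g is
needed. -/
theorem neg_tableG (s : Row) (α δ ξ y₀ y : ℝ) :
    -tableG s α δ ξ y₀ y = tableF s.swap α δ (-ξ) y₀ y := by
  have hD : δ ^ 2 - 4 * α * -ξ = δ ^ 2 + 4 * α * ξ := by ring
  cases s <;> simp only [tableG, tableF, Row.swap, hD] <;> ring

theorem neg_tableGRoot (s : Row) (α δ ξ : ℝ) :
    -tableGRoot s α δ ξ = tableFRoot s.swap α δ (-ξ) := by
  have hD : δ ^ 2 - 4 * α * -ξ = δ ^ 2 + 4 * α * ξ := by ring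
  cases s <;> simp only [tableGRoot, tableFRoot, Row.swap, hD] <;> ring

theorem regularG_iff (s : Row) (D y₀ y : ℝ) : regularG s D y₀ y ↔ regularF s.swap D y₀ y := by
  cases s <;> rfl

theorem signRelation_iff (r s : Row) (ε₁ ε₂ : ℝ) :
    SignRelation r s ε₁ ε₂ ↔ ε₁ = -(r.sgn * s.sgn) * ε₂ := by
  cases r <;> cases s <;> simp [SignRelation, Row.sgn]

/-- A real cubic with a double root has at most two complex roots. -/
theorem ncard_rootSet_le {a b c d t₁ t₂ : ℝ} (ha : a ≠ 0) (hb : b = -a * (t₁ + 2 * t₂))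
    (hc : c = a * (t₂ ^ 2 + 2 * t₁ * t₂)) (hd : d = -a * t₁ * t₂ ^ 2) :
    (Polynomial.rootSet (.C a * .X ^ 3 + .C b * .X ^ 2 + .C c * .X + .C d : Polynomial ℝ)
      ℂ).ncard ≤ 2 := by
  have hsub : Polynomial.rootSet
      (.C a * .X ^ 3 + .C b * .X ^ 2 + .C c * .X + .C d : Polynomial ℝ) ℂ
        ⊆ {(t₁ : ℂ), (t₂ : ℂ)} := by
    intro z hz
    have h1 := Polynomial.aeval_eq_zero_of_mem_rootSet hz
    simp only [map_add, map_mul, map_pow, Polynomial.aeval_X, Polynomial.aeval_C,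
      Complex.coe_algebraMap, hb, hc, hd] at h1
    push_cast at h1
    have h2 : (a : ℂ) * ((z - t₁) * (z - t₂) ^ 2) = 0 := by linear_combination h1
    have ha' : (a : ℂ) ≠ 0 := by exact_mod_cast ha
    rcases mul_eq_zero.1 ((mul_eq_zero.1 h2).resolve_left ha') with h3 | h3
    · exact Or.inl (sub_eq_zero.1 h3)
    · exact Or.inr (sub_eq_zero.1 (pow_eq_zero_iff two_ne_zero |>.1 h3))
  exact (Set.ncard_le_ncard hsub).trans ((Set.ncard_insert_le _ _).trans (by simp))

theorem QuadraticODE.exists_quadratic {I : Set ℝ} {γ : ℝ} {f : ℝ → ℝ}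
    (h : QuadraticODE I 0 0 γ f) (hγ : γ ≠ 0) :
    ∃ x₀ f₀, ∀ x ∈ I, f x = γ / 2 * (x - x₀) ^ 2 + f₀ := by
  obtain ⟨c, hc⟩ := exists_eq_const h.isOpen h.ordConnected (F := fun x => deriv f x - γ * x)
    (fun x hx => by
      refine ((h.hasDerivAt_deriv hx).fun_sub ((hasDerivAt_id x).const_mul γ)).congr_deriv ?_
      ring)
  obtain ⟨d, hd⟩ := exists_eq_const h.isOpen h.ordConnected
    (F := fun x => f x - (γ / 2 * x ^ 2 + c * x)) (fun x hx => by
      refine ((h.hasDerivAt hx).fun_sub ((((hasDerivAt_id x).fun_pow 2).const_mul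
        (γ / 2)).fun_add ((hasDerivAt_id x).const_mul c))).congr_deriv ?_
      rw [show deriv f x = γ * x + c by linarith [hc x hx]]
      push_cast
      simp only [id]
      ring)
  refine ⟨-c / γ, d - c ^ 2 / (2 * γ), fun x hx => ?_⟩
  rw [show f x = γ / 2 * x ^ 2 + c * x + d by linarith [hd x hx]]
  field_simp
  ring

/-! ### The case α ≠ 0: separating triples and their standard form -/

namespace CartesianSystem

variable {S : CartesianSystem}

theorem isTableG_iff (s : Row) :
    S.IsTableG s ↔ IsTableSolution S.J S.g (-S.α) S.δ S.ξ s.swap := by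
  have hD : S.δ ^ 2 - 4 * -S.α * S.ξ = S.δ ^ 2 + 4 * S.α * S.ξ := by ring
  have hs : s.swap ≠ .one ↔ s ≠ .one := by cases s <;> simp [Row.swap]
  have h1 : ∀ y₀ y, S.g y = tableG s S.α S.δ S.ξ y₀ y
      ↔ -S.g y = tableF s.swap S.α S.δ (-S.ξ) y₀ y := fun y₀ y => by
    rw [← neg_tableG, neg_inj]
  have h2 : ∀ y₀ y, -S.g y = tableG s (-S.α) S.δ (-S.ξ) y₀ y
      ↔ S.g y = tableF s.swap (-S.α) S.δ S.ξ y₀ y := fun y₀ y => by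
    have := neg_tableG s (-S.α) S.δ (-S.ξ) y₀ y
    rw [neg_neg] at this
    rw [← this, neg_eq_iff_eq_neg]
  simp only [IsTableG, IsTableSolution, hD, hs, h1, h2, regularG_iff, neg_neg, neg_pos,
    neg_lt_zero]
  rw [or_comm (a := 0 < S.α ∧ _)]

theorem tableC₁_eq (r : Row) (k : ℝ) :
    S.tableC₁ r k = 2 * k * simpleRoot r S.α S.β S.γ := by
  unfold tableC₁ simpleRoot
  split_ifs <;> ring

theorem tableC₂_eq (hα : S.α ≠ 0) (s : Row) (k : ℝ) :
    S.tableC₂ s k = -(2 * k * simpleRoot s.swap (-S.α) S.δ S.ξ) := by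
  have h1 := neg_tableGRoot s S.α S.δ S.ξ
  have h2 := neg_tableGRoot s (-S.α) S.δ (-S.ξ)
  rw [neg_neg] at h2
  unfold tableC₂ simpleRoot
  rcases lt_or_gt_of_ne hα with h | h
  · rw [if_neg h.not_gt, if_pos (neg_pos.2 h), ← h2]
    ring
  · rw [if_pos h, if_neg (by linarith), neg_neg, ← h1]
    ring

/-- The degenerate alternative p f' ≡ 0 would force α = 0. Otherwise p = 4k/(κ(f - t₂)) and 1/q =
4k/(κ(g - s₂)), so k and κ cancel in 1 + φ = pq. -/
theorem RealForm.exists_isRiccati {E lam : ℝ} {φ A B : ℝ → ℝ → ℝ} {p q a r η t : ℝ → ℝ}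
    (h : S.RealForm E lam φ A B p q a r η t) (hv : S.IsVectorPotential A B) (hα : S.α ≠ 0)
    (hf : ¬ ∃ c, ∀ x ∈ S.I, S.f x = c) (hg : ¬ ∃ c, ∀ y ∈ S.J, S.g y = c) :
    ∃ t₁ t₂ s₁ s₂, IsRiccati S.I S.f S.α t₁ t₂ ∧ IsRiccati S.J S.g (-S.α) s₁ s₂ ∧
      ∀ x ∈ S.I, ∀ y ∈ S.J, φ x y = (S.g y - s₂) / (S.f x - t₂) - 1 := by
  have hp0 : ∀ x ∈ S.I, p x ≠ 0 := by
    refine (h.ne_zero_or hv).resolve_right fun h0 => ?_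
    obtain ⟨κ, e, hl⟩ := h.exists_linear hv hf hg h0
    rcases exists_solution_of_linear S.odeG hg hl with h1 | h1
    · exact hα (neg_eq_zero.1 h1.1)
    · exact hα (neg_eq_zero.1 h1.1)
  obtain ⟨k, κ, n, l, p₁, q₁, hF, hG⟩ := h.exists_sideData hv hf hg hp0
  obtain ⟨hk, hκ, t₁, t₂, hR, hp⟩ := hF.of_ne_zero hα
  obtain ⟨-, -, s₁, s₂, hR', hq⟩ := hG.of_ne_zero (neg_ne_zero.2 hα)
  refine ⟨t₁, t₂, s₁, s₂, hR, hR', fun x hx y hy => ?_⟩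
  have ht : S.f x - t₂ ≠ 0 := by
    obtain ⟨U, hU⟩ := hR
    exact sub_ne_zero.2 (hU x hx).2.2
  have hs : S.g y - s₂ ≠ 0 := by
    obtain ⟨U, hU⟩ := hR'
    exact sub_ne_zero.2 (hU y hy).2.2
  have h1 := h.eq_phi x hx y hy
  have h2 := hp x hx
  have h3 := hq y hy
  have h4 := h.ne_zero y hy
  have h5 : q y = κ * (S.g y - s₂) / (4 * k) := by
    field_simp at h3 ⊢
    linear_combination -h3
  rw [h1, h2, h5]
  field_simp

theorem Separates.exists_isRiccati {E lam : ℝ} {φ A B : ℝ → ℝ → ℝ}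
    (hv : S.IsVectorPotential A B) (hs : S.Separates E lam φ A B) (hα : S.α ≠ 0)
    (hf : ¬ ∃ c, ∀ x ∈ S.I, S.f x = c) (hg : ¬ ∃ c, ∀ y ∈ S.J, S.g y = c) :
    ∃ t₁ t₂ s₁ s₂ : ℝ, ∃ τ η : ℝ → ℝ,
      IsRiccati S.I S.f S.α t₁ t₂ ∧ IsRiccati S.J S.g (-S.α) s₁ s₂ ∧
      ContDiffOn ℝ ∞ τ S.I ∧ ContDiffOn ℝ ∞ η S.J ∧
      ∀ x ∈ S.I, ∀ y ∈ S.J, φ x y = (S.g y - s₂) / (S.f x - t₂) - 1 ∧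
        A x y = τ x + φ x y / (1 + φ x y) * deriv S.g y ∧
        B x y = η y + φ x y * deriv S.f x := by
  obtain ⟨p, q, a, r, η, t, h⟩ := hs.exists_realForm hv hg
  obtain ⟨t₁, t₂, s₁, s₂, hR, hR', hφ⟩ := h.exists_isRiccati hv hα hf hg
  have ht : ∀ x ∈ S.I, S.f x - t₂ ≠ 0 := by
    obtain ⟨U, hU⟩ := hR
    exact fun x hx => sub_ne_zero.2 (hU x hx).2.2
  have hs : ∀ y ∈ S.J, S.g y - s₂ ≠ 0 := by
    obtain ⟨U, hU⟩ := hR'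
    exact fun x hx => sub_ne_zero.2 (hU x hx).2.2
  obtain ⟨x₀, hx₀⟩ := S.I_nonempty
  obtain ⟨y₀, hy₀⟩ := S.J_nonempty
  have hA : ∀ x ∈ S.I, ∀ y ∈ S.J,
      A x y = a x / p x + φ x y / (1 + φ x y) * deriv S.g y := by
    intro x hx y hy
    have h1 := h.eq_A x hx y hy
    have h2 : 1 + φ x y = p x * q y := by rw [h.eq_phi x hx y hy]; ring
    have h3 : p x * q y ≠ 0 := by
      rw [← h2, hφ x hx y hy]
      have := div_ne_zero (hs y hy) (ht x hx)
      simpa using this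
    have h4 := left_ne_zero_of_mul h3
    have h5 := right_ne_zero_of_mul h3
    rw [h2] at h1 ⊢
    field_simp
    linear_combination h1
  refine ⟨t₁, t₂, s₁, s₂, fun x => a x / p x, η, hR, hR', ?_, ?_, fun x hx y hy =>
    ⟨hφ x hx y hy, hA x hx y hy, h.eq_B x hx y hy⟩⟩
  -- Smoothness of τ and η is read off from the slices A(·, y₀) and B(x₀, ·), since a, p and η come
  -- without regularity.
  · have h1 : ContDiffOn ℝ ∞ (fun x => A x y₀) S.I :=
      hv.1.comp (contDiffOn_id.prodMk contDiffOn_const) fun x hx => ⟨hx, hy₀⟩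
    refine (h1.sub (((contDiffOn_const (c := 1)).sub ((S.odeF.smooth.sub
      (contDiffOn_const (c := t₂))).div_const (S.g y₀ - s₂))).mul
      (contDiffOn_const (c := deriv S.g y₀)))).congr fun x hx => ?_
    have h2 := ht x hx
    have h3 := hs y₀ hy₀
    have h4 := hA x hx y₀ hy₀
    rw [hφ x hx y₀ hy₀] at h4
    have h5 : ((S.g y₀ - s₂) / (S.f x - t₂) - 1) / (1 + ((S.g y₀ - s₂) / (S.f x - t₂) - 1))
        = 1 - (S.f x - t₂) / (S.g y₀ - s₂) := by
      rw [add_sub_cancel]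
      field_simp
    rw [h5] at h4
    linear_combination -h4
  · have h1 : ContDiffOn ℝ ∞ (fun y => B x₀ y) S.J :=
      hv.2.1.comp (contDiffOn_const.prodMk contDiffOn_id) fun y hy => ⟨hx₀, hy⟩
    refine (h1.sub ((((S.odeG.smooth.sub (contDiffOn_const (c := s₂))).div_const
      (S.f x₀ - t₂)).sub (contDiffOn_const (c := 1))).mul
      (contDiffOn_const (c := deriv S.f x₀)))).congr fun y hy => ?_
    have h4 := h.eq_B x₀ hx₀ y hy
    rw [hφ x₀ hx₀ y hy] at h4
    linear_combination -h4

section Riccati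

variable {t₁ t₂ s₁ s₂ : ℝ} {φ A B : ℝ → ℝ → ℝ} {τ η : ℝ → ℝ}

/-- With p = 1/(f - t₂) and q = g - s₂ one gets P = (α/3)U, Q = -(α/3)V and k = -α/3. Then u and w
have slopes -4α/3 and 4α/3, so the products fg cancel, and the imaginary condition is -PQ + QP = 0.
-/
theorem separates_of_isRiccati (hF : IsRiccati S.I S.f S.α t₁ t₂)
    (hG : IsRiccati S.J S.g (-S.α) s₁ s₂) (hα : S.α ≠ 0) (E lam : ℝ)
    (hτ : ContDiffOn ℝ ∞ τ S.I) (hη : ContDiffOn ℝ ∞ η S.J)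
    (hφ : ∀ x ∈ S.I, ∀ y ∈ S.J, φ x y = (S.g y - s₂) / (S.f x - t₂) - 1)
    (hA : ∀ x ∈ S.I, ∀ y ∈ S.J, A x y = τ x + φ x y / (1 + φ x y) * deriv S.g y)
    (hB : ∀ x ∈ S.I, ∀ y ∈ S.J, B x y = η y + φ x y * deriv S.f x) :
    S.IsVectorPotential A B ∧ S.Separates E lam φ A B := by
  obtain ⟨hβ, hγ⟩ := hF.coeffs S.odeF (hF.nonconst S.I_open S.I_nonempty hα)
  obtain ⟨hδ, hξ⟩ := hG.coeffs S.odeG (hG.nonconst S.J_open S.J_nonempty (neg_ne_zero.2 hα))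
  obtain ⟨U, hU⟩ := hF.exists_deriv_eq S.I_open
  obtain ⟨V, hV⟩ := hG.exists_deriv_eq S.J_open
  have ht : ∀ x ∈ S.I, S.f x - t₂ ≠ 0 := fun x hx => sub_ne_zero.2 (hU x hx).2.2.1
  have hs : ∀ y ∈ S.J, S.g y - s₂ ≠ 0 := fun y hy => sub_ne_zero.2 (hV y hy).2.2.1
  have hPU : ∀ x ∈ S.I, 1 / (S.f x - t₂) * deriv S.f x = S.α / 3 * U x := fun x hx => by
    have := ht x hx
    rw [(hU x hx).2.2.2]
    field_simp
  have hQV : ∀ y ∈ S.J, deriv S.g y / (S.g y - s₂) = -(S.α / 3) * V y := fun y hy => by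
    have := hs y hy
    rw [(hV y hy).2.2.2]
    field_simp
  refine separates_of_factors (p := fun x => 1 / (S.f x - t₂)) (q := fun y => S.g y - s₂)
    (p₁ := fun x => S.α / 3 * (S.f x - t₂)) (τ := τ) (η := η) (k := -(S.α / 3))
    (c₁ := -(2 * S.α / 3) * t₁) (c₂ := 2 * S.α / 3 * s₁)
    (X := fun x => S.f x * (2 * S.α / 3 * (s₁ + s₂)))
    (Y := fun y => -(S.g y * (2 * S.α / 3 * (t₁ + t₂))))
    (contDiffOn_const.div (S.odeF.smooth.sub contDiffOn_const) ht)
    (S.odeG.smooth.sub contDiffOn_const) hτ hη (fun x hx => one_div_ne_zero (ht x hx)) hs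
    (fun x hx => ?_) (fun x hx => ?_) (fun y hy => ?_) (fun x hx => ?_) (fun y hy => ?_)
    (fun x hx y hy => ?_) (fun x hx y hy => ?_) (fun x hx y hy => ?_) hA hB
  · refine ((hU x hx).1.const_mul (S.α / 3)).congr_of_eventuallyEq ?_
    filter_upwards [S.I_open.mem_nhds hx] with z hz using hPU z hz
  · have := ht x hx
    field_simp
  · refine ((hV y hy).1.const_mul (-(S.α / 3))).congr_of_eventuallyEq ?_
    filter_upwards [S.J_open.mem_nhds hy] with z hz using hQV z hz
  · simp only [hPU x hx]
    linear_combination -(2 * S.α / 3) * (hU x hx).2.1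
  · simp only [hQV y hy]
    linear_combination (2 * S.α / 3) * (hV y hy).2.1
  · have h1 := ht x hx
    have h2 := hs y hy
    have e1 : -S.α * S.g y ^ 2 + S.δ * S.g y + S.ξ
        = (S.g y - s₂) * (-(S.α / 3) * (S.g y - s₂) - 2 * S.α / 3 * (S.g y - s₁)) := by
      rw [hδ, hξ]; ring
    have e2 : S.α * S.f x ^ 2 + S.β * S.f x + S.γ
        = (S.f x - t₂) * (S.α / 3 * (S.f x - t₂) + 2 * S.α / 3 * (S.f x - t₁)) := by
      rw [hβ, hγ]; ring
    rw [e1, e2]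
    field_simp
    ring
  · have h1 := ht x hx
    have h2 := hs y hy
    have d1 : deriv (fun x => 1 / (S.f x - t₂)) x = -deriv S.f x / (S.f x - t₂) ^ 2 := by
      have := ((hasDerivAt_const x (1 : ℝ)).fun_div ((S.odeF.hasDerivAt hx).sub_const t₂) h1).deriv
      rw [this]
      ring
    have d2 : deriv (fun y => S.g y - s₂) y = deriv S.g y := deriv_sub_const _
    rw [d1, d2]
    field_simp
    ring
  · rw [hφ x hx y hy]
    ring

/-- Substituting the factored cubics, the product under the two roots is ((g - s₂)/(f - t₂))² for
every k ≠ 0. Only the sign of 1 + φ remains to be matched by ε₁/ε₂. -/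
theorem standardForm_of_isRiccati (hF : IsRiccati S.I S.f S.α t₁ t₂)
    (hG : IsRiccati S.J S.g (-S.α) s₁ s₂) {k ε₁ ε₂ : ℝ} (hk : k ≠ 0)
    (h₁ : IsSign ε₁) (h₂ : IsSign ε₂)
    (hε : ∀ x ∈ S.I, ∀ y ∈ S.J, 0 < ε₁ / ε₂ * ((S.g y - s₂) / (S.f x - t₂)))
    (hφ : ∀ x ∈ S.I, ∀ y ∈ S.J, φ x y = (S.g y - s₂) / (S.f x - t₂) - 1)
    (hA : ∀ x ∈ S.I, ∀ y ∈ S.J, A x y = τ x + φ x y / (1 + φ x y) * deriv S.g y)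
    (hB : ∀ x ∈ S.I, ∀ y ∈ S.J, B x y = η y + φ x y * deriv S.f x) :
    S.StandardForm k (2 * k * t₁) (-(2 * k * s₁)) ε₁ ε₂ τ η φ A B := by
  intro x hx y hy
  refine ⟨fun hfx hgy => ?_, hA x hx y hy, hB x hx y hy⟩
  have hf2 := hF.deriv_sq S.I_open x hx
  have hg2 := hG.deriv_sq S.J_open y hy
  have h3 : 0 < deriv S.f x ^ 2 := by positivity
  have h4 : 0 < deriv S.g y ^ 2 := by positivity
  rw [hf2] at h3
  rw [hg2] at h4
  have ht : S.f x - t₂ ≠ 0 := fun h0 => by rw [h0] at h3; simp at h3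
  have hs : S.g y - s₂ ≠ 0 := fun h0 => by rw [h0] at h4; simp at h4
  have h5 : 0 < S.α * (S.f x - t₁) := by
    have := pos_of_mul_pos_left h3 (sq_nonneg _)
    linarith
  have h6 : 0 < -S.α * (S.g y - s₁) := by
    have := pos_of_mul_pos_left h4 (sq_nonneg _)
    linarith
  have hα : S.α ≠ 0 := fun h0 => by rw [h0] at h5; simp at h5
  have hft : S.f x - t₁ ≠ 0 := fun h0 => by rw [h0] at h5; simp at h5
  have hgs : S.g y - s₁ ≠ 0 := fun h0 => by rw [h0] at h6; simp at h6
  have ec₁ : 2 * k * t₁ - 2 * k * S.f x = -(2 * k) * (S.f x - t₁) := by ring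
  have ec₂ : -(2 * k * s₁) + 2 * k * S.g y = 2 * k * (S.g y - s₁) := by ring
  rw [ec₁, ec₂]
  constructor
  · have h7 : -(2 * k) * (S.f x - t₁) * (2 * k * (S.g y - s₁))
        = (2 * k / S.α) ^ 2 * (S.α * (S.f x - t₁) * (-S.α * (S.g y - s₁))) := by
      field_simp
    rw [h7]
    have := mul_pos h5 h6
    positivity
  · have h8 : -(2 * k) * (S.f x - t₁) / (2 * k * (S.g y - s₁))
        * (deriv S.g y ^ 2 / deriv S.f x ^ 2) = ((S.g y - s₂) / (S.f x - t₂)) ^ 2 := by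
      rw [hf2, hg2]
      field_simp
    rw [mul_assoc, ← Real.sqrt_mul' _ (by positivity), h8, Real.sqrt_sq_eq_abs, hφ x hx y hy]
    have h9 := hε x hx y hy
    have h10 : (ε₁ / ε₂) ^ 2 = 1 := by rw [div_pow, h₁.sq, h₂.sq, div_one]
    generalize (S.g y - s₂) / (S.f x - t₂) = R at *
    rcases sq_eq_one_iff.1 h10 with h | h
    · rw [h, one_mul] at h9
      rw [h, abs_of_pos h9]; ring
    · rw [h] at h9
      rw [h, abs_of_neg (by linarith)]; ring

/-- Squaring the formula for 1 + φ gives (c₂ + 2kg)(f - t₁) + (c₁ - 2kf)(g - s₁) = 0. Two distinct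
values of f determine c₂, and two of g determine c₁. With these constants k = 0 would violate the
positivity of the product of the radicands. -/
theorem StandardForm.eq_of_isRiccati {k c₁ c₂ ε₁ ε₂ : ℝ}
    (h : S.StandardForm k c₁ c₂ ε₁ ε₂ τ η φ A B) (hF : IsRiccati S.I S.f S.α t₁ t₂)
    (hG : IsRiccati S.J S.g (-S.α) s₁ s₂) (hα : S.α ≠ 0) (h₁ : IsSign ε₁) (h₂ : IsSign ε₂)
    (hφ : ∀ x ∈ S.I, ∀ y ∈ S.J, φ x y = (S.g y - s₂) / (S.f x - t₂) - 1) :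
    k ≠ 0 ∧ c₁ = 2 * k * t₁ ∧ c₂ = -(2 * k * s₁) ∧
      ∃ x ∈ S.I, ∃ y ∈ S.J, 0 < ε₁ / ε₂ * ((S.g y - s₂) / (S.f x - t₂)) := by
  have hnf := hF.nonconst S.I_open S.I_nonempty hα
  have hng := hG.nonconst S.J_open S.J_nonempty (neg_ne_zero.2 hα)
  have h10 : (ε₁ / ε₂) ^ 2 = 1 := by rw [div_pow, h₁.sq, h₂.sq, div_one]
  have key : ∀ x ∈ S.I, ∀ y ∈ S.J, deriv S.f x ≠ 0 → deriv S.g y ≠ 0 →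
      0 < (c₁ - 2 * k * S.f x) * (c₂ + 2 * k * S.g y) ∧
      (c₂ + 2 * k * S.g y) * (S.f x - t₁) + (c₁ - 2 * k * S.f x) * (S.g y - s₁) = 0 ∧
      0 < ε₁ / ε₂ * ((S.g y - s₂) / (S.f x - t₂)) := by
    intro x hx y hy hfx hgy
    obtain ⟨⟨hpos, heq⟩, -, -⟩ := And.imp_left (fun h => h hfx hgy) (h x hx y hy)
    have hf2 := hF.deriv_sq S.I_open x hx
    have hg2 := hG.deriv_sq S.J_open y hy
    have ht : S.f x - t₂ ≠ 0 := fun h0 => by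
      rw [h0] at hf2
      exact hfx (by simpa using hf2)
    have hs : S.g y - s₂ ≠ 0 := fun h0 => by
      rw [h0] at hg2
      exact hgy (by simpa using hg2)
    have hc2 : c₂ + 2 * k * S.g y ≠ 0 := right_ne_zero_of_mul hpos.ne'
    have hr : 0 < (c₁ - 2 * k * S.f x) / (c₂ + 2 * k * S.g y) := by
      rw [show (c₁ - 2 * k * S.f x) / (c₂ + 2 * k * S.g y)
        = (c₁ - 2 * k * S.f x) * (c₂ + 2 * k * S.g y) / (c₂ + 2 * k * S.g y) ^ 2 by field_simp]
      positivity
    have hR : (S.g y - s₂) / (S.f x - t₂)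
        = ε₁ / ε₂ * (√((c₁ - 2 * k * S.f x) / (c₂ + 2 * k * S.g y))
          * √(deriv S.g y ^ 2 / deriv S.f x ^ 2)) := by
      rw [← mul_assoc, ← heq, hφ x hx y hy]; ring
    refine ⟨hpos, ?_, ?_⟩
    · have h5 : ((S.g y - s₂) / (S.f x - t₂)) ^ 2
          = (c₁ - 2 * k * S.f x) / (c₂ + 2 * k * S.g y)
            * (deriv S.g y ^ 2 / deriv S.f x ^ 2) := by
        rw [hR, mul_pow, mul_pow, h10, one_mul, Real.sq_sqrt hr.le, Real.sq_sqrt (by positivity)]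
      have h6 : (S.g y - s₂) ^ 2 * (c₂ + 2 * k * S.g y) * deriv S.f x ^ 2
          = (S.f x - t₂) ^ 2 * ((c₁ - 2 * k * S.f x) * deriv S.g y ^ 2) := by
        generalize c₂ + 2 * k * S.g y = d at *
        generalize c₁ - 2 * k * S.f x = c at *
        field_simp at h5
        linear_combination h5
      rw [hf2, hg2] at h6
      have h7 : 2 / 3 * S.α * (S.g y - s₂) ^ 2 * (S.f x - t₂) ^ 2 ≠ 0 := by positivity
      apply mul_left_cancel₀ h7
      linear_combination h6
    · rw [hR, ← mul_assoc, ← sq, h10, one_mul]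
      positivity
  obtain ⟨x₁, hx₁, x₂, hx₂, hf1, hf2, hne⟩ := S.odeF.exists_ne hnf
  obtain ⟨y₁, hy₁, y₂, hy₂, hg1, hg2, hne'⟩ := S.odeG.exists_ne hng
  obtain ⟨a1, a2, a3⟩ := key x₁ hx₁ y₁ hy₁ hf1 hg1
  obtain ⟨-, b2, -⟩ := key x₂ hx₂ y₁ hy₁ hf2 hg1
  obtain ⟨-, d2, -⟩ := key x₁ hx₁ y₂ hy₂ hf1 hg2
  have e2 : c₂ = -(2 * k * s₁) := by
    apply mul_left_cancel₀ (sub_ne_zero.2 hne)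
    linear_combination a2 - b2
  have e1 : c₁ = 2 * k * t₁ := by
    apply mul_left_cancel₀ (sub_ne_zero.2 hne')
    linear_combination a2 - d2
  refine ⟨?_, e1, e2, x₁, hx₁, y₁, hy₁, a3⟩
  rintro rfl
  rw [e1, e2] at a1
  simp at a1

end Riccati

/-! ### Assembly of the cases -/

theorem quasiseparates_cases {E lam : ℝ} (h : S.Quasiseparates E lam)
    (hf : ¬ ∃ c, ∀ x ∈ S.I, S.f x = c) (hg : ¬ ∃ c, ∀ y ∈ S.J, S.g y = c) :
    S.Case1 ∨ S.Case2 ∨ S.Case3 ∨ S.Case4 := by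
  obtain ⟨φ, A, B, hv, hs⟩ := h
  by_cases hα : S.α = 0
  · have hlin : (∃ κ e, ∀ y ∈ S.J, deriv S.g y = κ * S.g y + e) →
        S.Case1 ∨ S.Case2 ∨ S.Case3 ∨ S.Case4 := by
      rintro ⟨κ, e, hl⟩
      rcases exists_solution_of_linear S.odeG hg hl with ⟨-, h1⟩ | ⟨-, h1⟩
      · exact Or.inl ⟨hα, h1⟩
      · exact Or.inr (Or.inl ⟨hα, h1⟩)
    obtain ⟨p, q, a, r, η, t, h⟩ := hs.exists_realForm hv hg
    rcases h.ne_zero_or hv with hp0 | hp0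
    · obtain ⟨k, κ, n, l, p₁, q₁, hF, hG⟩ := h.exists_sideData hv hf hg hp0
      by_cases hk : k = 0
      · exact hlin ((hG.of_eq_zero (by simpa using hα)).1 (by simpa using hk))
      · obtain ⟨hβ, hkγ⟩ := (hF.of_eq_zero hα).2 hk
        obtain ⟨hδ, hkξ⟩ := (hG.of_eq_zero (by simpa using hα)).2 (by simpa using hk)
        -- The two sides give kγ < 0 and (-k)ξ < 0; their product is -k²ξγ > 0.
        have hξγ : S.ξ * S.γ < 0 := by
          have h1 : k ^ 2 * (S.ξ * S.γ) < 0 := by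
            have := mul_pos_of_neg_of_neg hkγ hkξ
            linarith
          exact neg_of_mul_neg_right h1 (sq_nonneg k)
        have hodeF := S.odeF
        have hodeG := S.odeG
        rw [hα, hβ] at hodeF
        rw [hα, hδ, neg_zero] at hodeG
        obtain ⟨x₀, f₀, hF2⟩ := hodeF.exists_quadratic (right_ne_zero_of_mul hξγ.ne)
        obtain ⟨y₀, g₀, hG2⟩ := hodeG.exists_quadratic (left_ne_zero_of_mul hξγ.ne)
        exact Or.inr (Or.inr (Or.inl ⟨hα, hβ, hδ, hξγ, x₀, y₀, f₀, g₀, hF2, hG2⟩))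
    · exact hlin (h.exists_linear hv hf hg hp0)
  · obtain ⟨t₁, t₂, s₁, s₂, -, -, hF, hG, -⟩ := hs.exists_isRiccati hv hα hf hg
    obtain ⟨r, hr⟩ := hF.exists_isTableSolution hα S.odeF hf
    obtain ⟨s, hs⟩ := hG.exists_isTableSolution (neg_ne_zero.2 hα) S.odeG hg
    refine Or.inr (Or.inr (Or.inr ⟨hα, r, s.swap, hr, ?_⟩))
    rw [isTableG_iff, Row.swap_swap]
    exact hs

/-- The sign of `1 + φ` in terms of the rows of the tables. -/
theorem sign_div {r s : Row} {α u w : ℝ} (hα : α ≠ 0) (hu : 0 < r.sgn * (α * u))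
    (hw : 0 < s.swap.sgn * (-α * w)) : 0 < -(r.sgn * s.sgn) * (w / u) := by
  rw [Row.sgn_swap] at hw
  have hu0 : u ≠ 0 := by rintro rfl; simp at hu
  have h1 := mul_pos hu hw
  have h2 : -(r.sgn * s.sgn) * (w / u)
      = r.sgn * (α * u) * (s.sgn * (-α * w)) / (α * u) ^ 2 := by field_simp
  rw [h2]
  positivity

theorem exists_separating_triple {r s : Row} (hα : S.α ≠ 0) (hr : S.IsTableF r)
    (hs : S.IsTableG s) (E lam : ℝ) {k ε₁ ε₂ : ℝ} (hk : k ≠ 0) (h₁ : IsSign ε₁)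
    (h₂ : IsSign ε₂) (hε : SignRelation r s ε₁ ε₂) {τ η : ℝ → ℝ}
    (hτ : ContDiffOn ℝ ∞ τ S.I) (hη : ContDiffOn ℝ ∞ η S.J) :
    ∃ φ A B : ℝ → ℝ → ℝ, ContDiffOn ℝ ∞ (Function.uncurry φ) (S.I ×ˢ S.J) ∧
      S.StandardForm k (S.tableC₁ r k) (S.tableC₂ s k) ε₁ ε₂ τ η φ A B ∧
      S.IsVectorPotential A B ∧ S.Separates E lam φ A B := by
  obtain ⟨t₂, hF, hsF⟩ := IsTableSolution.exists_isRiccati (f := S.f) hr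
  obtain ⟨s₂, hG, hsG⟩ := ((isTableG_iff s).1 hs).exists_isRiccati
  have ht : ∀ x ∈ S.I, S.f x - t₂ ≠ 0 := by
    obtain ⟨U, hU⟩ := hF
    exact fun x hx => sub_ne_zero.2 (hU x hx).2.2
  refine ⟨fun x y => (S.g y - s₂) / (S.f x - t₂) - 1,
    fun x y => τ x + ((S.g y - s₂) / (S.f x - t₂) - 1)
      / (1 + ((S.g y - s₂) / (S.f x - t₂) - 1)) * deriv S.g y,
    fun x y => η y + ((S.g y - s₂) / (S.f x - t₂) - 1) * deriv S.f x, ?_, ?_, ?_⟩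
  · exact ((S.odeG.smooth.comp_snd_prod.sub contDiffOn_const).div
      (S.odeF.smooth.comp_fst_prod.sub contDiffOn_const) fun z hz => ht z.1 hz.1).sub
      contDiffOn_const
  · rw [tableC₁_eq, tableC₂_eq hα]
    refine standardForm_of_isRiccati hF hG hk h₁ h₂ (fun x hx y hy => ?_)
      (fun _ _ _ _ => rfl) (fun _ _ _ _ => rfl) (fun _ _ _ _ => rfl)
    rw [(signRelation_iff r s ε₁ ε₂).1 hε, mul_div_cancel_right₀ _ h₂.ne_zero]
    exact sign_div hα (hsF x hx) (hsG y hy)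
  · exact separates_of_isRiccati hF hG hα E lam hτ hη
      (fun _ _ _ _ => rfl) (fun _ _ _ _ => rfl) (fun _ _ _ _ => rfl)

theorem standardForm_of_separates {r s : Row} (hα : S.α ≠ 0) (hr : S.IsTableF r)
    (hs : S.IsTableG s) {E lam : ℝ} {φ A B : ℝ → ℝ → ℝ} (hv : S.IsVectorPotential A B)
    (hsep : S.Separates E lam φ A B) :
    (∃ τ η : ℝ → ℝ, ContDiffOn ℝ ∞ τ S.I ∧ ContDiffOn ℝ ∞ η S.J ∧
      ∀ k ε₁ ε₂ : ℝ, k ≠ 0 → IsSign ε₁ → IsSign ε₂ → SignRelation r s ε₁ ε₂ →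
        S.StandardForm k (S.tableC₁ r k) (S.tableC₂ s k) ε₁ ε₂ τ η φ A B) ∧
    (∀ (k c₁ c₂ ε₁ ε₂ : ℝ) (τ η : ℝ → ℝ), IsSign ε₁ → IsSign ε₂ →
      S.StandardForm k c₁ c₂ ε₁ ε₂ τ η φ A B →
        k ≠ 0 ∧ c₁ = S.tableC₁ r k ∧ c₂ = S.tableC₂ s k ∧ SignRelation r s ε₁ ε₂) := by
  obtain ⟨t₂, hF, hsF⟩ := IsTableSolution.exists_isRiccati (f := S.f) hr
  obtain ⟨s₂, hG, hsG⟩ := ((isTableG_iff s).1 hs).exists_isRiccati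
  have hα' := neg_ne_zero.2 hα
  have hnf := hF.nonconst S.I_open S.I_nonempty hα
  have hng := hG.nonconst S.J_open S.J_nonempty hα'
  obtain ⟨t₁', t₂', s₁', s₂', τ, η, hF', hG', hτ, hη, h⟩ := hsep.exists_isRiccati hv hα hnf hng
  obtain ⟨rfl, rfl⟩ := hF'.unique hF hα S.I_open S.I_interval S.odeF.continuousOn hnf
  obtain ⟨rfl, rfl⟩ := hG'.unique hG hα' S.J_open S.J_interval S.odeG.continuousOn hng
  constructor
  · refine ⟨τ, η, hτ, hη, fun k ε₁ ε₂ hk h₁ h₂ hε => ?_⟩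
    rw [tableC₁_eq, tableC₂_eq hα]
    refine standardForm_of_isRiccati hF hG hk h₁ h₂ (fun x hx y hy => ?_)
      (fun x hx y hy => (h x hx y hy).1) (fun x hx y hy => (h x hx y hy).2.1)
      (fun x hx y hy => (h x hx y hy).2.2)
    rw [(signRelation_iff r s ε₁ ε₂).1 hε, mul_div_cancel_right₀ _ h₂.ne_zero]
    exact sign_div hα (hsF x hx) (hsG y hy)
  · intro k c₁ c₂ ε₁ ε₂ τ' η' h₁ h₂ hst
    obtain ⟨hk, e1, e2, x, hx, y, hy, hpos⟩ :=
      hst.eq_of_isRiccati hF hG hα h₁ h₂ fun x hx y hy => (h x hx y hy).1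
    refine ⟨hk, by rw [tableC₁_eq, e1], by rw [tableC₂_eq hα, e2], ?_⟩
    have h3 := sign_div hα (hsF x hx) (hsG y hy)
    have h4 : (r.sgn * s.sgn) ^ 2 = 1 := by rw [mul_pow, r.sgn_sq, s.sgn_sq, one_mul]
    rw [signRelation_iff]
    generalize (S.g y - _) / (S.f x - _) = R at *
    generalize r.sgn * s.sgn = σ at *
    rcases sq_eq_one_iff.1 h4 with rfl | rfl <;>
      rcases h₁ with rfl | rfl <;> rcases h₂ with rfl | rfl <;> norm_num at * <;> linarith

/-- Separation forces f'² = (2α/3)(f - t₁)(f - t₂)² and similarly for g. Comparing coefficients,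
both P₃ and Q₃ have a double root, hence at most two distinct complex roots. -/
theorem not_quasiseparates {E lam σ₁ σ₂ : ℝ} (hα : S.α ≠ 0)
    (hf : ¬ ∃ c, ∀ x ∈ S.I, S.f x = c) (hg : ¬ ∃ c, ∀ y ∈ S.J, S.g y = c)
    (hσ₁ : ∀ x ∈ S.I, deriv S.f x ^ 2 = (S.P₃ σ₁).eval (S.f x))
    (hσ₂ : ∀ y ∈ S.J, deriv S.g y ^ 2 = (S.Q₃ σ₂).eval (S.g y))
    (h3 : ((S.P₃ σ₁).rootSet ℂ).ncard = 3 ∨ ((S.Q₃ σ₂).rootSet ℂ).ncard = 3) :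
    ¬ S.Quasiseparates E lam := by
  rintro ⟨φ, A, B, hv, hs⟩
  obtain ⟨t₁, t₂, s₁, s₂, -, -, hF, hG, -⟩ := hs.exists_isRiccati hv hα hf hg
  rcases h3 with h3 | h3
  · obtain ⟨-, -, e2, e1, e0⟩ := coeffs_eq_zero S.I_interval S.odeF.continuousOn hf (a₄ := 0)
      (a₃ := 0) (a₂ := S.β + 2 / 3 * S.α * (t₁ + 2 * t₂))
      (a₁ := 2 * S.γ - 2 / 3 * S.α * (t₂ ^ 2 + 2 * t₁ * t₂))
      (a₀ := σ₁ + 2 / 3 * S.α * t₁ * t₂ ^ 2) (fun x hx => by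
        have h1 := hσ₁ x hx
        rw [hF.deriv_sq S.I_open x hx] at h1
        simp [P₃] at h1
        linear_combination -h1)
    have := ncard_rootSet_le (a := 2 / 3 * S.α) (b := S.β) (c := 2 * S.γ) (d := σ₁) (t₁ := t₁)
      (t₂ := t₂) (by simpa using hα) (by linarith) (by linarith) (by linarith)
    rw [P₃] at h3
    omega
  · obtain ⟨-, -, e2, e1, e0⟩ := coeffs_eq_zero S.J_interval S.odeG.continuousOn hg (a₄ := 0)
      (a₃ := 0) (a₂ := S.δ - 2 / 3 * S.α * (s₁ + 2 * s₂))
      (a₁ := 2 * S.ξ + 2 / 3 * S.α * (s₂ ^ 2 + 2 * s₁ * s₂))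
      (a₀ := σ₂ - 2 / 3 * S.α * s₁ * s₂ ^ 2) (fun y hy => by
        have h1 := hσ₂ y hy
        rw [hG.deriv_sq S.J_open y hy] at h1
        simp [Q₃] at h1
        linear_combination -h1)
    have := ncard_rootSet_le (a := -(2 / 3) * S.α) (b := S.δ) (c := 2 * S.ξ) (d := σ₂) (t₁ := s₁)
      (t₂ := s₂) (by simpa using hα) (by linarith) (by linarith) (by linarith)
    rw [Q₃] at h3
    omega

end CartesianSystem

end

theorem mainTheorem1 (S : CartesianSystem) (E lam : ℝ)
    (hS : ∃ x ∈ S.I, ∃ y ∈ S.J, deriv (deriv S.f) x ^ 2 + deriv (deriv S.g) y ^ 2 ≠ 0) :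
    -- the classification of the separable cases
    ((¬ ∃ c, ∀ x ∈ S.I, S.f x = c) → (¬ ∃ c, ∀ y ∈ S.J, S.g y = c) →
      (S.Quasiseparates E lam ↔ S.Case1 ∨ S.Case2 ∨ S.Case3 ∨ S.Case4)) ∧
    -- cases 1 and 2: one can take `φ = -1`, `A = g'`, `B = -f'`, modified by `τ(x)`, `η(y)`
    (S.Case1 ∨ S.Case2 → ∀ τ η : ℝ → ℝ, ContDiffOn ℝ ∞ τ S.I → ContDiffOn ℝ ∞ η S.J →
      S.IsVectorPotential (fun x y => deriv S.g y + τ x) (fun x y => -deriv S.f x + η y) ∧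
      S.Separates E lam (fun _ _ => -1)
        (fun x y => deriv S.g y + τ x) (fun x y => -deriv S.f x + η y)) ∧
    -- case 3: `φ` is a constant with `(1 + φ)² = -ξ/γ`; `c₁ = c₂ = 0` when `f₀ = g₀ = 0`
    (S.Case3 → ∀ ε₁ ε₂ : ℝ, IsSign ε₁ → IsSign ε₂ →
      ∀ τ η : ℝ → ℝ, ContDiffOn ℝ ∞ τ S.I → ContDiffOn ℝ ∞ η S.J →
      ∀ φ : ℝ, φ = -1 + ε₁ / ε₂ * √(-S.ξ / S.γ) →
      S.IsVectorPotential (fun x y => φ / (1 + φ) * deriv S.g y + τ x)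
        (fun x y => φ * deriv S.f x + η y) ∧
      S.Separates E lam (fun _ _ => φ) (fun x y => φ / (1 + φ) * deriv S.g y + τ x)
        (fun x y => φ * deriv S.f x + η y) ∧
      ∀ k x₀ y₀ f₀ g₀ : ℝ, k ≠ 0 → S.IsQuadratic x₀ y₀ f₀ g₀ →
        S.StandardForm k (2 * k * f₀) (-(2 * k * g₀)) ε₁ ε₂ τ η (fun _ _ => φ)
          (fun x y => φ / (1 + φ) * deriv S.g y + τ x) (fun x y => φ * deriv S.f x + η y)) ∧
    -- case 4: the standard form with the constants of the tables separates, every separating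
    -- triple has this form, and the constants are determined
    (∀ r s : Row, S.α ≠ 0 → S.IsTableF r → S.IsTableG s →
      (∀ k ε₁ ε₂ : ℝ, k ≠ 0 → IsSign ε₁ → IsSign ε₂ → SignRelation r s ε₁ ε₂ →
        ∀ τ η : ℝ → ℝ, ContDiffOn ℝ ∞ τ S.I → ContDiffOn ℝ ∞ η S.J →
        ∃ φ A B : ℝ → ℝ → ℝ, ContDiffOn ℝ ∞ (Function.uncurry φ) (S.I ×ˢ S.J) ∧
          S.StandardForm k (S.tableC₁ r k) (S.tableC₂ s k) ε₁ ε₂ τ η φ A B ∧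
          S.IsVectorPotential A B ∧ S.Separates E lam φ A B) ∧
      (∀ φ A B : ℝ → ℝ → ℝ, S.IsVectorPotential A B → S.Separates E lam φ A B →
        (∃ τ η : ℝ → ℝ, ContDiffOn ℝ ∞ τ S.I ∧ ContDiffOn ℝ ∞ η S.J ∧
          ∀ k ε₁ ε₂ : ℝ, k ≠ 0 → IsSign ε₁ → IsSign ε₂ → SignRelation r s ε₁ ε₂ →
            S.StandardForm k (S.tableC₁ r k) (S.tableC₂ s k) ε₁ ε₂ τ η φ A B) ∧
        (∀ (k c₁ c₂ ε₁ ε₂ : ℝ) (τ η : ℝ → ℝ), IsSign ε₁ → IsSign ε₂ →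
          S.StandardForm k c₁ c₂ ε₁ ε₂ τ η φ A B →
            k ≠ 0 ∧ c₁ = S.tableC₁ r k ∧ c₂ = S.tableC₂ s k ∧ SignRelation r s ε₁ ε₂))) ∧
    -- for `α ≠ 0`, elliptic solutions (cubics with three distinct roots) never separate
    (S.α ≠ 0 → (¬ ∃ c, ∀ x ∈ S.I, S.f x = c) → (¬ ∃ c, ∀ y ∈ S.J, S.g y = c) →
      ∀ σ₁ σ₂ : ℝ, (∀ x ∈ S.I, deriv S.f x ^ 2 = (S.P₃ σ₁).eval (S.f x)) →
        (∀ y ∈ S.J, deriv S.g y ^ 2 = (S.Q₃ σ₂).eval (S.g y)) →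
        ((S.P₃ σ₁).rootSet ℂ).ncard = 3 ∨ ((S.Q₃ σ₂).rootSet ℂ).ncard = 3 →
        ¬ S.Quasiseparates E lam) := by
  have hb : ∀ τ η : ℝ → ℝ, ContDiffOn ℝ ∞ τ S.I → ContDiffOn ℝ ∞ η S.J → S.Case1 ∨ S.Case2 →
      _ := fun τ η hτ hη h => CartesianSystem.separates_of_case_one_or_two h E lam hτ hη
  have h1 : IsSign 1 := Or.inl rfl
  have h0I : ContDiffOn ℝ ∞ (fun _ : ℝ => (0 : ℝ)) S.I := contDiffOn_const
  have h0J : ContDiffOn ℝ ∞ (fun _ : ℝ => (0 : ℝ)) S.J := contDiffOn_const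
  refine ⟨fun hf hg => ⟨fun h => CartesianSystem.quasiseparates_cases h hf hg, ?_⟩,
    fun h τ η hτ hη => hb τ η hτ hη h,
    fun h ε₁ ε₂ h₁ h₂ τ η hτ hη φ hφ =>
      CartesianSystem.separates_of_case_three h E lam h₁ h₂ hτ hη hφ,
    fun r s hα hr hs => ⟨fun k ε₁ ε₂ hk h₁ h₂ hε τ η hτ hη =>
      CartesianSystem.exists_separating_triple hα hr hs E lam hk h₁ h₂ hε hτ hη,
      fun φ A B hv hsep => CartesianSystem.standardForm_of_separates hα hr hs hv hsep⟩,
    fun hα hf hg σ₁ σ₂ hσ₁ hσ₂ h3 =>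
      CartesianSystem.not_quasiseparates hα hf hg hσ₁ hσ₂ h3⟩
  rintro (h | h | h | ⟨hα, r, s, hr, hs⟩)
  · exact ⟨_, _, _, hb _ _ h0I h0J (Or.inl h)⟩
  · exact ⟨_, _, _, hb _ _ h0I h0J (Or.inr h)⟩
  · obtain ⟨h2, h3, -⟩ := CartesianSystem.separates_of_case_three h E lam h1 h1 h0I h0J rfl
    exact ⟨_, _, _, h2, h3⟩
  -- The choice ε₂ = 1, ε₁ = -(sgn r)(sgn s) satisfies the sign relation for every pair of rows.
  · obtain ⟨φ, A, B, -, -, h2⟩ := CartesianSystem.exists_separating_triple hα hr hs E lam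
      (k := 1) (ε₁ := -(r.sgn * s.sgn)) (ε₂ := 1) one_ne_zero
      (sq_eq_one_iff.1 (by rw [neg_sq, mul_pow, r.sgn_sq, s.sgn_sq, one_mul])) h1
      ((signRelation_iff r s _ _).2 (by ring)) h0I h0J
    exact ⟨φ, A, B, h2⟩
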